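/- **Model.** Let $\lambda,\mu,\rho\in[0,1]$ be constants, put $$F(\lambda,\mu,\rho,\gamma)=\max\Big\{\frac{\lambda^2}{\gamma},\ \frac{\mu^2}{\gamma},\ \frac{\lambda^2\rho^2}{\gamma-\lambda^2+\lambda^2\rho^2}+\frac{\mu^2\rho^2}{\gamma-\mu^2+\mu^2\rho^2}\Big\}$$ (with $0/0=0$), and assume that $F(\lambda,\mu,\rho,1)>1+\epsilon$ for some constant $\epsilon>0$. Let $C$ be a constant and, for each $n$, let $\pi_*=\pi_{*,n}$ be the law of a pair $(\mathbb X,\mathbb Y)$ of real random variables with $\mathbb E\mathbb X=\mathbb E\mathbb Y=0$, $\mathbb E\mathbb X^2=\mathbb E\mathbb Y^2=1$, $\mathbb E[\mathbb X\mathbb Y]=\rho$ and $\mathbb E\mathbb X^4,\mathbb E\mathbb Y^4\le C$ ($\pi_*$ may in particular be the same for all $n$). An $n\times n$ Wigner matrix is a symmetric random matrix with independent entries $W_{i,j}\sim\mathcal N(0,1+\mathbf 1_{i=j})$, $i\le j$. Let $W,Z$ be independent $n\times n$ Wigner matrices, and let $(x_1,y_1),\dots,(x_n,y_n)$ be i.i.d.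 with law $\pi_*$, independent of $(W,Z)$. Let $\mathbb P=\mathbb P_n$ be the law of $(X,Y)$, where $$X=\tfrac{\lambda}{\sqrt n}xx^\top+W,\qquad Y=\tfrac{\mu}{\sqrt n}yy^\top+Z,$$ and let $\mathbb Q=\mathbb Q_n$ be the law of $(W,Z)$. **Statistic.** A decorated graph is a finite simple graph $H$ each of whose edges is decorated by $\bullet$ or $\circ$; $E_\bullet(H)$ and $E_\circ(H)$ are the sets of edges with the respective decoration, and $\mathsf{diff}(H)$ is the set of vertices incident both to an edge in $E_\bullet(H)$ and to an edge in $E_\circ(H)$. Isomorphisms are bijections of the vertex sets that preserve edges and decorations, $[H]$ is the isomorphism class of $H$, and $|\mathsf{Aut}(H)|$ is the number of automorphisms. Let $\mathcal H=\mathcal H(\ell)$ be the set of isomorphism classes of decorated cycles with $\ell\geq 3$ vertices (empty if $\ell<3$), and put $$\Xi(H)=\lambda^{|E_\bullet(H)|}\mu^{|E_\circ(H)|}\rho^{|\mathsf{diff}(H)|},\qquad \beta_{\mathcal H}=\sum_{[H]\in\mathcal H}\frac{\Xi(H)^2}{|\mathsf{Aut}(H)|},$$ $$f_{\mathcal H}(X,Y)=\frac1{\sqrt{n^\ell\beta_{\mathcal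 H}}}\sum_{[H]\in\mathcal H}\Xi(H)\sum_{S\subset\mathsf K_n,\,S\cong H}\ \prod_{(i,j)\in E_\bullet(S)}X_{i,j}\prod_{(i,j)\in E_\circ(S)}Y_{i,j},$$ where $\mathsf K_n$ is the complete graph on $\{1,\dots,n\}$ and $S$ runs over its decorated subgraphs (and $f_{\mathcal H}=0$ if $\mathcal H$ is empty). **Theorem.** Let $\ell=\ell_n$ satisfy $\ell_n\to\infty$ and $\ell_n=o\big(\tfrac{\log n}{\log\log n}\big)$ as $n\to\infty$, let $0<c<1$ be a constant, and let $\tau=\tau_n=c\cdot\mathbb E_{\mathbb P}[f_{\mathcal H}(X,Y)]$. Then this expectation exists, i.e. $f_{\mathcal H}$ is $\mathbb P$-integrable, and $$\mathbb P\big(f_{\mathcal H}(X,Y)\le\tau\big)+\mathbb Q\big(f_{\mathcal H}(X,Y)\ge\tau\big)\longrightarrow 0\qquad(n\to\infty).$$ In particular the test $\mathcal A$ that outputs $1$ if $f_{\mathcal H}(X,Y)\ge\tau$ and $0$ if $f_{\mathcal H}(X,Y)<\tau$ achieves strong detection between $\mathbb P$ and $\mathbb Q$: $$\mathbb P\big(\mathcal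 A(X,Y)=0\big)+\mathbb Q\big(\mathcal A(X,Y)=1\big)\longrightarrow0\qquad(n\to\infty).$$ -/

import Mathlib

open MeasureTheory ProbabilityTheory Filter Topology
open scoped BigOperators

noncomputable section

/-! ### Decorated graphs -/

/-- A (finite) decorated graph with vertices in `V`: a vertex set, an edge set without loops, and
a decoration of each edge by `•` or `∘`. The edge set and its decoration are recorded by the set
`bullet` of edges decorated by `•` and the set `circ` of edges decorated by `∘`; these are
disjoint and their union is the edge set. -/
@[ext]
structure DecoratedGraph (V : Type) where
  verts : Finset V
  bullet : Finset (Sym2 V)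
  circ : Finset (Sym2 V)
  disjoint_edges : Disjoint bullet circ
  loopless : ∀ e, e ∈ bullet ∨ e ∈ circ → ¬ e.IsDiag
  incident : ∀ e, e ∈ bullet ∨ e ∈ circ → ∀ v ∈ e, v ∈ verts

namespace DecoratedGraph

variable {V W : Type}

instance [Finite V] : Finite (DecoratedGraph V) :=
  Finite.of_injective
    (fun H : DecoratedGraph V => (H.verts, H.bullet, H.circ))
    (fun H K h => by
      simp only [Prod.mk.injEq] at h
      exact DecoratedGraph.ext h.1 h.2.1 h.2.2)

instance [Finite V] : Fintype (DecoratedGraph V) := Fintype.ofFinite _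

/-- The underlying undecorated graph, on the vertex set of `H`. -/
def toGraph (H : DecoratedGraph V) : SimpleGraph H.verts where
  Adj u v := s(u.1, v.1) ∈ H.bullet ∨ s(u.1, v.1) ∈ H.circ
  symm := ⟨fun u v h => by rwa [Sym2.eq_swap (a := v.1)]⟩
  loopless := ⟨fun u h => H.loopless _ h (Sym2.mk_isDiag_iff.2 rfl)⟩

open Classical in
/-- The vertices incident to some edge decorated by `•`. -/
def bulletVerts (H : DecoratedGraph V) : Finset V :=
  H.verts.filter fun v => ∃ u ∈ H.verts, s(v, u) ∈ H.bullet

open Classical in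
/-- The vertices incident to some edge decorated by `∘`. -/
def circVerts (H : DecoratedGraph V) : Finset V :=
  H.verts.filter fun v => ∃ u ∈ H.verts, s(v, u) ∈ H.circ

open Classical in
/-- The vertices incident both to an edge decorated by `•` and to an edge decorated by `∘`. -/
def diff (H : DecoratedGraph V) : Finset V := H.bulletVerts ∩ H.circVerts

/-- A bijection of the vertex sets is an isomorphism of decorated graphs if it maps the `•`-edges
onto the `•`-edges and the `∘`-edges onto the `∘`-edges. -/
def IsIso (H : DecoratedGraph V) (K : DecoratedGraph W) (σ : H.verts ≃ K.verts) : Prop :=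
  ∀ u v : H.verts,
    (s(u.1, v.1) ∈ H.bullet ↔ s((σ u).1, (σ v).1) ∈ K.bullet) ∧
    (s(u.1, v.1) ∈ H.circ ↔ s((σ u).1, (σ v).1) ∈ K.circ)

/-- `H ≅ K`. -/
def Isomorphic (H : DecoratedGraph V) (K : DecoratedGraph W) : Prop :=
  ∃ σ : H.verts ≃ K.verts, IsIso H K σ

/-- The number of automorphisms of `H`. -/
def autCount (H : DecoratedGraph V) : ℕ :=
  Nat.card {σ : H.verts ≃ H.verts // IsIso H H σ}

/-- `H` is a decorated cycle of length `l`. -/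
def IsCycle (l : ℕ) (H : DecoratedGraph V) : Prop :=
  3 ≤ l ∧ Nonempty (SimpleGraph.cycleGraph l ≃g H.toGraph)

/-- Isomorphism as an equivalence relation. -/
def isoSetoid (V : Type) : Setoid (DecoratedGraph V) where
  r H K := Isomorphic H K
  iseqv :=
    { refl := fun H => ⟨Equiv.refl _, fun _ _ => ⟨Iff.rfl, Iff.rfl⟩⟩
      symm := by
        rintro H K ⟨σ, h⟩
        refine ⟨σ.symm, fun u v => ?_⟩
        have := h (σ.symm u) (σ.symm v)
        simp only [Equiv.apply_symm_apply] at this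
        exact ⟨this.1.symm, this.2.symm⟩
      trans := by
        rintro H K L ⟨σ, h⟩ ⟨τ, h'⟩
        exact ⟨σ.trans τ, fun u v =>
          ⟨(h u v).1.trans (h' _ _).1, (h u v).2.trans (h' _ _).2⟩⟩ }

/-- The weight `lam ^ |E_•(H)| * mu ^ |E_∘(H)| * rho ^ |diff(H)|`. -/
def weight (lam mu rho : ℝ) (H : DecoratedGraph V) : ℝ :=
  lam ^ H.bullet.card * mu ^ H.circ.card * rho ^ H.diff.card

end DecoratedGraph

/-- An unlabeled decorated graph on at most `l` vertices: an isomorphism class of decorated graphs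
with vertices in `Fin l`. -/
abbrev UnlabeledGraph (l : ℕ) : Type := Quotient (DecoratedGraph.isoSetoid (Fin l))

instance (l : ℕ) : Fintype (UnlabeledGraph l) := Fintype.ofFinite _

open Classical in
/-- The collection of unlabeled decorated cycles of length `l`. Each of them has exactly `l`
vertices, hence a representative with vertices in `Fin l`. -/
def cycleClasses (l : ℕ) : Finset (UnlabeledGraph l) :=
  Finset.univ.filter fun h =>
    ∃ H : DecoratedGraph (Fin l), H.IsCycle l ∧ Quotient.mk (DecoratedGraph.isoSetoid (Fin l)) H = h

/-! ### The statistic -/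

instance {m n : Type} : MeasurableSpace (Matrix m n ℝ) :=
  inferInstanceAs (MeasurableSpace (m → n → ℝ))

/-- A pair of real `n × n` matrices. -/
abbrev MatrixPair (n : ℕ) : Type := Matrix (Fin n) (Fin n) ℝ × Matrix (Fin n) (Fin n) ℝ

/-- The product of the entries `X i j` over the `•`-edges `{i, j}` of `S` and of the entries
`Y i j` over its `∘`-edges. An edge `e` is read as the pair `e.inf < e.sup`; the matrices of
interest are symmetric, so that the order is immaterial. -/
def edgeProduct {n : ℕ} (S : DecoratedGraph (Fin n)) (M : MatrixPair n) : ℝ :=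
  (∏ e ∈ S.bullet, M.1 e.inf e.sup) * ∏ e ∈ S.circ, M.2 e.inf e.sup

/-- The normalization `∑_{[H]} weight(H)^2 / |Aut(H)|`, over unlabeled decorated cycles `[H]` of
length `l`. The summand does not depend on the representative. -/
def cycleBeta (lam mu rho : ℝ) (l : ℕ) : ℝ :=
  ∑ h ∈ cycleClasses l, h.out.weight lam mu rho ^ 2 / (h.out.autCount : ℝ)

open Classical in
/-- The weighted count of decorated cycles of length `l` in a pair of `n × n` matrices. -/
def cycleStat (lam mu rho : ℝ) (l n : ℕ) (M : MatrixPair n) : ℝ :=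
  1 / √((n : ℝ) ^ l * cycleBeta lam mu rho l) *
    ∑ h ∈ cycleClasses l, h.out.weight lam mu rho *
      ∑ S : DecoratedGraph (Fin n) with h.out.Isomorphic S, edgeProduct S M

/-- The test with threshold `τ`: it outputs `1` if the statistic is at least `τ`, otherwise `0`. -/
def cycleTest (lam mu rho : ℝ) (l n : ℕ) (τ : ℝ) (M : MatrixPair n) : Fin 2 :=
  if τ ≤ cycleStat lam mu rho l n M then 1 else 0

/-! ### The model -/

/-- The law of a Wigner matrix: a symmetric matrix whose entries `W i j`, one for each unordered
pair `s(i, j)`, are independent centered Gaussians of variance `1` off the diagonal and `2` on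
the diagonal. -/
def wignerLaw (n : ℕ) : Measure (Matrix (Fin n) (Fin n) ℝ) :=
  (Measure.pi fun e : Sym2 (Fin n) => gaussianReal 0 (if e.IsDiag then 2 else 1)).map
    fun g => Matrix.of fun i j => g s(i, j)

/-- The law of a pair of independent Wigner matrices. -/
def nullLaw (n : ℕ) : Measure (MatrixPair n) := (wignerLaw n).prod (wignerLaw n)

/-- The law of the correlated spiked Wigner model
`(lam / √n • x xᵀ + W, mu / √n • y yᵀ + Z)`, where the pairs `(x i, y i)` are independent with
law `prior`, and are independent of the pair `(W, Z)` of independent Wigner matrices. -/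
def spikedLaw (lam mu : ℝ) (prior : Measure (ℝ × ℝ)) (n : ℕ) : Measure (MatrixPair n) :=
  ((Measure.pi fun _ : Fin n => prior).prod (nullLaw n)).map fun ω =>
    ((lam / √(n : ℝ)) • Matrix.vecMulVec (fun i => (ω.1 i).1) (fun i => (ω.1 i).1) + ω.2.1,
     (mu / √(n : ℝ)) • Matrix.vecMulVec (fun i => (ω.1 i).2) (fun i => (ω.1 i).2) + ω.2.2)

/-- The prior `p` is the law of a pair of centered random variables with unit variances,
correlation `rho`, and fourth moments that are finite and at most `C`. -/
structure IsCorrelatedPrior (p : Measure (ℝ × ℝ)) (rho C : ℝ) : Prop where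
  prob : IsProbabilityMeasure p
  integrable_fst_four : Integrable (fun z => z.1 ^ 4) p
  integrable_snd_four : Integrable (fun z => z.2 ^ 4) p
  mean_fst : ∫ z, z.1 ∂p = 0
  mean_snd : ∫ z, z.2 ∂p = 0
  var_fst : ∫ z, z.1 ^ 2 ∂p = 1
  var_snd : ∫ z, z.2 ^ 2 ∂p = 1
  corr : ∫ z, z.1 * z.2 ∂p = rho
  fourth_fst : ∫ z, z.1 ^ 4 ∂p ≤ C
  fourth_snd : ∫ z, z.2 ^ 4 ∂p ≤ C

/-- The threshold function
`max {lam²/g, mu²/g, lam²rho²/(g - lam² + lam²rho²) + mu²rho²/(g - mu² + mu²rho²)}`. -/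
def thresholdF (lam mu rho g : ℝ) : ℝ :=
  max (lam ^ 2 / g) (max (mu ^ 2 / g)
    (lam ^ 2 * rho ^ 2 / (g - lam ^ 2 + lam ^ 2 * rho ^ 2) +
      mu ^ 2 * rho ^ 2 / (g - mu ^ 2 + mu ^ 2 * rho ^ 2)))

/-- The tests `A n`, with values in `{0, 1}`, achieve strong detection between `P` and `Q`. -/
def StrongDetection (P Q : ∀ n : ℕ, Measure (MatrixPair n)) (A : ∀ n : ℕ, MatrixPair n → Fin 2) :
    Prop :=
  Tendsto (fun n => P n {M | A n M = 0} + Q n {M | A n M = 1}) atTop (𝓝 0)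

end

/-! ### Labeled cycles -/

/-- A cycle of length `k + 3` in `V` with a starting point, an orientation and a decoration of its
edges; `true` stands for `•` and `false` for `∘`. -/
abbrev LabeledCycle (k : ℕ) (V : Type) : Type := (Fin (k + 3) ↪ V) × (Fin (k + 3) → Bool)

namespace LabeledCycle

variable {k : ℕ} {V : Type}

theorem succ_ne (i : Fin (k + 3)) : i + 1 ≠ i := by
  intro h
  simp at h

theorem succ_succ_ne (i : Fin (k + 3)) : i + 1 + 1 ≠ i := by
  intro h
  have h1 : (1 + 1 : Fin (k + 3)) = 0 := by
    rw [add_assoc] at h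
    simpa using h
  have h2 := congrArg Fin.val h1
  rw [Fin.val_add] at h2
  simp only [Fin.val_one, Fin.val_zero] at h2
  rw [Nat.mod_eq_of_lt (by omega)] at h2
  omega

/-- The `i`-th decorated edge. -/
def edge (p : LabeledCycle k V) (i : Fin (k + 3)) : Sym2 V × Bool :=
  (s(p.1 i, p.1 (i + 1)), p.2 i)

theorem mk_succ_injective (φ : Fin (k + 3) ↪ V) :
    Function.Injective fun i => s(φ i, φ (i + 1)) := by
  intro i j h
  simp only [Sym2.eq_iff, EmbeddingLike.apply_eq_iff_eq] at h
  rcases h with h | h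
  · exact h.1
  · exact absurd (by rw [← h.1, h.2] : j + 1 + 1 = j) (succ_succ_ne j)

theorem edge_injective (p : LabeledCycle k V) : Function.Injective p.edge := fun _ _ h =>
  mk_succ_injective p.1 (congrArg Prod.fst h)

theorem not_isDiag_edge (p : LabeledCycle k V) (i : Fin (k + 3)) : ¬ (p.edge i).1.IsDiag := by
  simp only [edge, Sym2.mk_isDiag_iff, EmbeddingLike.apply_eq_iff_eq]
  exact fun h => succ_ne i h.symm

/-- The set of decorated edges. -/
def edges (p : LabeledCycle k V) : Finset (Sym2 V × Bool) :=
  Finset.univ.map ⟨p.edge, p.edge_injective⟩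

theorem mem_edges {p : LabeledCycle k V} {d : Sym2 V × Bool} :
    d ∈ p.edges ↔ ∃ i, p.edge i = d := by
  simp [edges]

theorem card_edges (p : LabeledCycle k V) : p.edges.card = k + 3 := by simp [edges]

theorem prod_edges {M : Type*} [CommMonoid M] (p : LabeledCycle k V) (f : Sym2 V × Bool → M) :
    ∏ d ∈ p.edges, f d = ∏ i, f (p.edge i) := by simp [edges]

open Fin.CommRing in
theorem eq_of_edges_eq {p q : LabeledCycle k V} (h : p.edges = q.edges) (h0 : p.1 0 = q.1 0)
    (h1 : p.1 1 = q.1 1) : p = q := by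
  have key : ∀ m : ℕ, p.1 (m : Fin (k + 3)) = q.1 (m : Fin (k + 3)) ∧
      p.1 ((m : Fin (k + 3)) + 1) = q.1 ((m : Fin (k + 3)) + 1) := by
    intro m
    induction m with
    | zero => simpa using ⟨h0, h1⟩
    | succ m ih =>
      rw [Nat.cast_succ]
      refine ⟨ih.2, ?_⟩
      have hm : p.edge ((m : Fin (k + 3)) + 1) ∈ q.edges := h ▸ mem_edges.2 ⟨_, rfl⟩
      obtain ⟨j, hj⟩ := mem_edges.1 hm
      have hj1 := congrArg Prod.fst hj
      simp only [edge, Sym2.eq_iff] at hj1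
      rw [ih.2] at hj1
      rcases hj1 with hj1 | hj1
      · rw [← hj1.2, q.1.injective hj1.1]
      · have e1 : j = (m : Fin (k + 3)) := add_right_cancel (q.1.injective hj1.2)
        rw [e1, ← ih.1] at hj1
        exact absurd (p.1.injective hj1.1).symm (succ_succ_ne _)
  have hφ : p.1 = q.1 := by
    ext i
    simpa using (key i.val).1
  refine Prod.ext hφ ?_
  funext i
  have hm : p.edge i ∈ q.edges := h ▸ mem_edges.2 ⟨_, rfl⟩
  obtain ⟨j, hj⟩ := mem_edges.1 hm
  have hj1 := congrArg Prod.fst hj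
  have hj2 := congrArg Prod.snd hj
  simp only [edge] at hj1 hj2
  rw [hφ] at hj1
  rw [← hj2, mk_succ_injective q.1 hj1]

theorem apply_mem_range_of_edges_eq {p q : LabeledCycle k V} (h : p.edges = q.edges)
    (i : Fin (k + 3)) : q.1 i ∈ Set.range p.1 := by
  have hm : q.edge i ∈ p.edges := h ▸ mem_edges.2 ⟨_, rfl⟩
  obtain ⟨j, hj⟩ := mem_edges.1 hm
  have hj1 := congrArg Prod.fst hj
  simp only [edge, Sym2.eq_iff] at hj1
  rcases hj1 with hj1 | hj1
  · exact ⟨_, hj1.1⟩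
  · exact ⟨_, hj1.2⟩

variable [DecidableEq V]

/-- A decorated cycle has at most `(k + 3) ^ 2` labelings. -/
theorem card_edges_eq_le [Fintype V] (p : LabeledCycle k V) :
    (Finset.univ.filter fun q : LabeledCycle k V => q.edges = p.edges).card ≤ (k + 3) ^ 2 := by
  have hc : ((Finset.univ.map p.1) ×ˢ (Finset.univ.map p.1)).card = (k + 3) ^ 2 := by
    simp [sq]
  rw [← hc]
  refine Finset.card_le_card_of_injOn (fun q => (q.1 0, q.1 1)) ?_ ?_
  · intro q hq
    have hq' : q.edges = p.edges := by simpa using hq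
    have := apply_mem_range_of_edges_eq hq'.symm
    simpa using ⟨this 0, this 1⟩
  · intro q hq q' hq' h
    have e : q.edges = p.edges := by simpa using hq
    have e' : q'.edges = p.edges := by simpa using hq'
    simp only [Prod.mk.injEq] at h
    exact eq_of_edges_eq (e.trans e'.symm) h.1 h.2

/-- The number of vertices of `q` that lie on `p`. -/
def overlap (p q : LabeledCycle k V) : ℕ :=
  (Finset.univ.filter fun j => q.1 j ∈ Finset.univ.map p.1).card

theorem overlap_eq_zero {p q : LabeledCycle k V} (h : overlap p q = 0) (i j : Fin (k + 3)) :
    p.1 i ≠ q.1 j := by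
  intro e
  have h1 := Finset.card_eq_zero.1 h
  have : j ∈ (Finset.univ.filter fun j => q.1 j ∈ Finset.univ.map p.1) := by
    simpa using ⟨i, e⟩
  rw [h1] at this
  simp at this

open Fin.CommRing in
theorem card_inter_edges_lt_overlap {p q : LabeledCycle k V} (h : p.edges ≠ q.edges)
    (hv : overlap p q ≠ 0) : (p.edges ∩ q.edges).card + 1 ≤ overlap p q := by
  set F : Finset (Fin (k + 3)) := Finset.univ.filter fun j => q.edge j ∈ p.edges with hF
  set U : Finset (Fin (k + 3)) := Finset.univ.filter fun j => q.1 j ∈ Finset.univ.map p.1 with hU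
  have hcard : (p.edges ∩ q.edges).card = F.card := by
    rw [← Finset.card_map ⟨q.edge, q.edge_injective⟩ (s := F)]
    congr 1
    ext d
    simp only [Finset.mem_inter, Finset.mem_map, hF, Finset.mem_filter, Finset.mem_univ, true_and,
      Function.Embedding.coeFn_mk, mem_edges (p := q)]
    constructor
    · rintro ⟨h1, i, rfl⟩
      exact ⟨i, h1, rfl⟩
    · rintro ⟨i, h1, rfl⟩
      exact ⟨h1, i, rfl⟩
  have hFU : ∀ j ∈ F, j ∈ U ∧ j + 1 ∈ U := by
    intro j hj
    simp only [hF, Finset.mem_filter, Finset.mem_univ, true_and, mem_edges] at hj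
    obtain ⟨i, hi⟩ := hj
    have hi1 := congrArg Prod.fst hi
    simp only [edge, Sym2.eq_iff] at hi1
    simp only [hU, Finset.mem_filter, Finset.mem_univ, true_and, Finset.mem_map]
    rcases hi1 with hi1 | hi1
    · exact ⟨⟨_, hi1.1⟩, ⟨_, hi1.2⟩⟩
    · exact ⟨⟨_, hi1.2⟩, ⟨_, hi1.1⟩⟩
  change _ ≤ U.card
  rw [hcard]
  change U.card ≠ 0 at hv
  by_contra hlt
  have hUF : U.card ≤ F.card := by omega
  have hsub : F ⊆ U := fun j hj => (hFU j hj).1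
  have hEq : F = U := Finset.eq_of_subset_of_card_le hsub hUF
  have hne : F.Nonempty := by
    rw [hEq]
    exact Finset.card_pos.1 (Nat.pos_of_ne_zero hv)
  obtain ⟨a, ha⟩ := hne
  have hstep : ∀ m : ℕ, a + (m : Fin (k + 3)) ∈ F := by
    intro m
    induction m with
    | zero => simpa using ha
    | succ m ih =>
      rw [Nat.cast_succ, ← add_assoc]
      rw [hEq]
      exact (hFU _ ih).2
  have hall : ∀ j, j ∈ F := by
    intro j
    have := hstep (j - a).val
    simpa using this
  apply h
  refine (Finset.eq_of_subset_of_card_le ?_ ?_).symm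
  · intro d hd
    obtain ⟨j, rfl⟩ := mem_edges.1 hd
    have := hall j
    simpa [hF] using this
  · rw [card_edges, card_edges]

/-- Summing `N ^ overlap p q` over all labeled cycles `q`. -/
theorem sum_pow_overlap_le [Fintype V] (p : LabeledCycle k V) :
    ∑ q : LabeledCycle k V, (Fintype.card V : ℝ) ^ overlap p q ≤
      (2 * (Fintype.card V * (k + 4))) ^ (k + 3) := by
  set N : ℝ := ((Fintype.card V : ℕ) : ℝ) with hN
  have hN0 : 0 ≤ N := by positivity
  have h1 : ∀ q : LabeledCycle k V, N ^ overlap p q =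
      ∏ j, (if q.1 j ∈ Finset.univ.map p.1 then N else 1) := by
    intro q
    rw [Finset.prod_ite]
    simp [overlap]
  simp only [h1]
  have h0 : ∑ q : LabeledCycle k V, ∏ j, (if q.1 j ∈ Finset.univ.map p.1 then N else 1) =
      ∑ φ : Fin (k + 3) ↪ V, ∑ _s : Fin (k + 3) → Bool,
        ∏ j, (if φ j ∈ Finset.univ.map p.1 then N else 1) := Fintype.sum_prod_type _
  rw [h0]
  simp only [Finset.sum_const, Finset.card_univ, Fintype.card_fun, Fintype.card_bool,
    Fintype.card_fin, nsmul_eq_mul]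
  rw [← Finset.mul_sum, mul_pow]
  push_cast
  gcongr
  have h2 : ∑ φ : Fin (k + 3) ↪ V, ∏ j, (if φ j ∈ Finset.univ.map p.1 then N else 1) ≤
      ∑ φ : Fin (k + 3) → V, ∏ j, (if φ j ∈ Finset.univ.map p.1 then N else 1) := by
    rw [← Finset.sum_image (s := Finset.univ) (g := fun φ : Fin (k + 3) ↪ V => (φ : Fin (k + 3) → V))
      (f := fun φ : Fin (k + 3) → V => ∏ j, (if φ j ∈ Finset.univ.map p.1 then N else 1))
      (fun _ _ _ _ h => DFunLike.coe_injective h)]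
    refine Finset.sum_le_sum_of_subset_of_nonneg (Finset.subset_univ _) fun φ _ _ => ?_
    refine Finset.prod_nonneg fun j _ => ?_
    split_ifs <;> positivity
  refine h2.trans ?_
  rw [← Fintype.sum_pow (fun x => if x ∈ Finset.univ.map p.1 then N else 1)]
  have h3 : ∑ x : V, (if x ∈ Finset.univ.map p.1 then N else 1) ≤ N * (k + 4) := by
    rw [Finset.sum_ite]
    have h4 : (Finset.univ.filter fun x => x ∈ Finset.univ.map p.1).card = k + 3 := by
      rw [Finset.filter_mem_eq_inter]
      simp
    rw [Finset.sum_const, Finset.sum_const, h4]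
    have h5 : ((Finset.univ.filter fun x => x ∉ Finset.univ.map p.1).card : ℝ) ≤ N := by
      rw [hN]
      exact_mod_cast Finset.card_le_univ _
    simp only [nsmul_eq_mul, mul_one]
    push_cast
    linarith
  have h6 : 0 ≤ ∑ x : V, (if x ∈ Finset.univ.map p.1 then N else 1) :=
    Finset.sum_nonneg fun x _ => by split_ifs <;> positivity
  gcongr

end LabeledCycle

/-! ### Moments of product measures -/

theorem integral_prod_comp_pi {ι κ α : Type*} [Fintype ι] [Fintype κ] [MeasurableSpace α]
    (p : Measure α) [IsProbabilityMeasure p] {θ : ι → κ} (hθ : Function.Injective θ)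
    {F : ι → α → ℝ} (hF : ∀ i, Measurable (F i)) :
    ∫ x, ∏ i, F i (x (θ i)) ∂(Measure.pi fun _ : κ => p) = ∏ i, ∫ z, F i z ∂p := by
  have h1 : iIndepFun (fun (j : κ) (x : κ → α) => x j) (Measure.pi fun _ : κ => p) :=
    iIndepFun_pi (X := fun _ => id) fun _ => aemeasurable_id
  have h2 := h1.precomp hθ
  have h3 := h2.integral_fun_prod_comp (f := F)
    (fun i => (measurable_pi_apply (θ i)).aemeasurable)
    (fun i => (hF i).aestronglyMeasurable)
  refine h3.trans (Finset.prod_congr rfl fun i _ => ?_)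
  have h4 := measurePreserving_eval (fun _ : κ => p) (θ i)
  have h5 := integral_map (μ := Measure.pi fun _ : κ => p) h4.measurable.aemeasurable
    (hF i).aestronglyMeasurable
  rw [h4.map_eq] at h5
  exact h5.symm

/-- The component of a pair selected by a decoration. -/
def coord (b : Bool) (z : ℝ × ℝ) : ℝ := cond b z.1 z.2

/-- The envelope `1 + |x| + |y|` of a pair `(x, y)`. -/
def envelope (z : ℝ × ℝ) : ℝ := 1 + |z.1| + |z.2|

theorem measurable_coord (b : Bool) : Measurable (coord b) := by
  cases b
  · exact measurable_snd
  · exact measurable_fst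

theorem measurable_envelope : Measurable envelope := by
  unfold envelope
  fun_prop

theorem one_le_envelope (z : ℝ × ℝ) : 1 ≤ envelope z := by
  unfold envelope
  linarith [abs_nonneg z.1, abs_nonneg z.2]

theorem envelope_nonneg (z : ℝ × ℝ) : 0 ≤ envelope z := zero_le_one.trans (one_le_envelope z)

theorem one_add_abs_coord_le (b : Bool) (z : ℝ × ℝ) : 1 + |coord b z| ≤ envelope z := by
  cases b <;> simp only [coord, envelope, cond_true, cond_false] <;>
    linarith [abs_nonneg z.1, abs_nonneg z.2]

theorem abs_coord_le (b : Bool) (z : ℝ × ℝ) : |coord b z| ≤ envelope z := by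
  linarith [one_add_abs_coord_le b z]

theorem one_add_coord_sq_le (b : Bool) (z : ℝ × ℝ) : 1 + coord b z ^ 2 ≤ envelope z ^ 2 := by
  have h := one_add_abs_coord_le b z
  have h0 := abs_nonneg (coord b z)
  rw [← sq_abs]
  nlinarith

theorem envelope_pow_four_le (z : ℝ × ℝ) : envelope z ^ 4 ≤ 27 * (1 + z.1 ^ 4 + z.2 ^ 4) := by
  have h : ∀ a b c : ℝ, (a + b + c) ^ 4 ≤ 27 * (a ^ 4 + b ^ 4 + c ^ 4) := by
    intro a b c
    have h1 : (a + b + c) ^ 2 ≤ 3 * (a ^ 2 + b ^ 2 + c ^ 2) := by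
      nlinarith [sq_nonneg (a - b), sq_nonneg (b - c), sq_nonneg (a - c)]
    have h2 : (a ^ 2 + b ^ 2 + c ^ 2) ^ 2 ≤ 3 * (a ^ 4 + b ^ 4 + c ^ 4) := by
      nlinarith [sq_nonneg (a ^ 2 - b ^ 2), sq_nonneg (b ^ 2 - c ^ 2), sq_nonneg (a ^ 2 - c ^ 2)]
    have h3 : ((a + b + c) ^ 2) ^ 2 ≤ (3 * (a ^ 2 + b ^ 2 + c ^ 2)) ^ 2 := by gcongr
    nlinarith
  have h1 := h 1 |z.1| |z.2|
  have e1 : |z.1| ^ 4 = z.1 ^ 4 := by rw [← abs_pow, abs_of_nonneg (by positivity)]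
  have e2 : |z.2| ^ 4 = z.2 ^ 4 := by rw [← abs_pow, abs_of_nonneg (by positivity)]
  rw [e1, e2, one_pow] at h1
  exact h1

namespace IsCorrelatedPrior

variable {p : Measure (ℝ × ℝ)} {rho C : ℝ}

theorem integrable_envelope (hp : IsCorrelatedPrior p rho C) :
    Integrable (fun z => envelope z ^ 4) p := by
  have := hp.prob
  have h : Integrable (fun z : ℝ × ℝ => 27 * (1 + z.1 ^ 4 + z.2 ^ 4)) p :=
    (((integrable_const 1).add hp.integrable_fst_four).add hp.integrable_snd_four).const_mul 27
  refine h.mono' (measurable_envelope.pow_const 4).aestronglyMeasurable (ae_of_all _ fun z => ?_)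
  rw [Real.norm_of_nonneg (pow_nonneg (envelope_nonneg z) 4)]
  exact envelope_pow_four_le z

theorem integral_envelope_le (hp : IsCorrelatedPrior p rho C) :
    ∫ z, envelope z ^ 4 ∂p ≤ 27 * (1 + 2 * C) := by
  have := hp.prob
  have h1 : Integrable (fun z : ℝ × ℝ => 1 + z.1 ^ 4) p :=
    (integrable_const (1 : ℝ)).add hp.integrable_fst_four
  have h : Integrable (fun z : ℝ × ℝ => 27 * (1 + z.1 ^ 4 + z.2 ^ 4)) p :=
    (h1.add hp.integrable_snd_four).const_mul 27
  refine (integral_mono hp.integrable_envelope h envelope_pow_four_le).trans ?_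
  rw [integral_const_mul, integral_add h1 hp.integrable_snd_four,
    integral_add (integrable_const (1 : ℝ)) hp.integrable_fst_four]
  simp only [integral_const, probReal_univ, smul_eq_mul]
  linarith [hp.fourth_fst, hp.fourth_snd]

theorem one_le_integral_envelope (hp : IsCorrelatedPrior p rho C) :
    1 ≤ ∫ z, envelope z ^ 4 ∂p := by
  have := hp.prob
  have := integral_mono (integrable_const (1 : ℝ)) hp.integrable_envelope
    (fun z => one_le_pow₀ (one_le_envelope z))
  simpa using this

theorem integral_coord_mul (hp : IsCorrelatedPrior p rho C) (b b' : Bool) :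
    ∫ z, coord b z * coord b' z ∂p = if b = b' then 1 else rho := by
  have h1 := hp.var_fst
  have h2 := hp.var_snd
  have h3 := hp.corr
  cases b <;> cases b' <;> simp only [coord, cond_true, cond_false, ← sq] <;> simp [h1, h2, h3]
  simpa only [mul_comm] using h3

end IsCorrelatedPrior

/-! ### Gaussian moments -/

theorem integral_add_id_gaussianReal (a : ℝ) (v : NNReal) :
    ∫ z, (a + z) ∂(gaussianReal 0 v) = a := by
  have h : Integrable (fun z : ℝ => z) (gaussianReal 0 v) :=
    (memLp_id_gaussianReal (μ := 0) (v := v) 1).integrable (by simp)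
  rw [integral_add (integrable_const a) h, integral_id_gaussianReal]
  simp

theorem integrable_sq_gaussianReal (v : NNReal) :
    Integrable (fun z : ℝ => z ^ 2) (gaussianReal 0 v) :=
  (memLp_id_gaussianReal (μ := 0) (v := v) 2).integrable_sq

theorem integral_sq_gaussianReal (v : NNReal) :
    ∫ z, z ^ 2 ∂(gaussianReal 0 v) = v := by
  have h := variance_id_gaussianReal (μ := 0) (v := v)
  rw [variance_eq_integral aemeasurable_id] at h
  simpa [integral_id_gaussianReal] using h

theorem integral_add_id_sq_gaussianReal (a : ℝ) (v : NNReal) :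
    ∫ z, (a + z) ^ 2 ∂(gaussianReal 0 v) = a ^ 2 + v := by
  have h : Integrable (fun z : ℝ => z) (gaussianReal 0 v) :=
    (memLp_id_gaussianReal (μ := 0) (v := v) 1).integrable (by simp)
  have h2 := integrable_sq_gaussianReal v
  have e : (fun z : ℝ => (a + z) ^ 2) = fun z => (a ^ 2 + 2 * a * z) + z ^ 2 := by
    funext z; ring
  have h3 : Integrable (fun z : ℝ => a ^ 2 + 2 * a * z) (gaussianReal 0 v) :=
    (integrable_const _).add (h.const_mul _)
  rw [e, integral_add h3 h2, integral_add (integrable_const _) (h.const_mul _), integral_const_mul,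
    integral_id_gaussianReal, integral_sq_gaussianReal]
  simp

/-! ### The noise -/

/-- The law of the independent entries of a Wigner matrix. -/
noncomputable def wignerEntryLaw (n : ℕ) : Measure (Sym2 (Fin n) → ℝ) :=
  Measure.pi fun e : Sym2 (Fin n) => gaussianReal 0 (if e.IsDiag then 2 else 1)

instance (n : ℕ) : IsProbabilityMeasure (wignerEntryLaw n) := by
  unfold wignerEntryLaw
  infer_instance

/-- The noise in the entry `d`. -/
def noise {n : ℕ} (g : (Sym2 (Fin n) → ℝ) × (Sym2 (Fin n) → ℝ)) (d : Sym2 (Fin n) × Bool) : ℝ :=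
  cond d.2 (g.1 d.1) (g.2 d.1)

theorem integral_prod_noise {n : ℕ} (F : Sym2 (Fin n) × Bool → ℝ → ℝ) :
    ∫ g, ∏ d, F d (noise g d) ∂((wignerEntryLaw n).prod (wignerEntryLaw n)) =
      ∏ d, ∫ z, F d z ∂(gaussianReal 0 (if d.1.IsDiag then 2 else 1)) := by
  simp only [Fintype.prod_prod_type_right, Fintype.prod_bool, noise, cond_true, cond_false]
  rw [integral_prod_mul (fun g : Sym2 (Fin n) → ℝ => ∏ e, F (e, true) (g e))
    (fun g : Sym2 (Fin n) → ℝ => ∏ e, F (e, false) (g e))]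
  unfold wignerEntryLaw
  rw [integral_fintype_prod_eq_prod, integral_fintype_prod_eq_prod]

theorem integrable_prod_noise {n : ℕ} (F : Sym2 (Fin n) × Bool → ℝ → ℝ)
    (hF : ∀ d, Integrable (F d) (gaussianReal 0 (if d.1.IsDiag then 2 else 1))) :
    Integrable (fun g => ∏ d, F d (noise g d)) ((wignerEntryLaw n).prod (wignerEntryLaw n)) := by
  simp only [Fintype.prod_prod_type_right, Fintype.prod_bool, noise, cond_true, cond_false]
  unfold wignerEntryLaw
  exact (Integrable.fintype_prod fun e => hF (e, true)).mul_prod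
    (Integrable.fintype_prod fun e => hF (e, false))

/-- The second moments of products of noisy entries. -/
theorem integral_prod_add_noise {n : ℕ} (a : Sym2 (Fin n) × Bool → ℝ)
    {D D' : Finset (Sym2 (Fin n) × Bool)} (hD : ∀ d ∈ D, ¬ d.1.IsDiag) :
    ∫ g, (∏ d ∈ D, (a d + noise g d)) * ∏ d ∈ D', (a d + noise g d)
        ∂((wignerEntryLaw n).prod (wignerEntryLaw n)) =
      (∏ d ∈ D ∩ D', (1 + a d ^ 2)) * ((∏ d ∈ D \ D', a d) * ∏ d ∈ D' \ D, a d) := by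
  have e1 : ∀ g : (Sym2 (Fin n) → ℝ) × (Sym2 (Fin n) → ℝ),
      (∏ d ∈ D, (a d + noise g d)) * ∏ d ∈ D', (a d + noise g d) =
        ∏ d, (fun d z => (if d ∈ D then a d + z else 1) * (if d ∈ D' then a d + z else 1)) d
          (noise g d) := by
    intro g
    simp only [Finset.prod_mul_distrib, Finset.prod_ite_mem, Finset.univ_inter]
  refine (integral_congr_ae (ae_of_all _ e1)).trans ((integral_prod_noise fun d z =>
    (if d ∈ D then a d + z else 1) * (if d ∈ D' then a d + z else 1)).trans ?_)
  rw [← Finset.univ_inter (D ∩ D'), ← Finset.univ_inter (D \ D'), ← Finset.univ_inter (D' \ D),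
    ← Finset.prod_ite_mem, ← Finset.prod_ite_mem, ← Finset.prod_ite_mem,
    ← Finset.prod_mul_distrib, ← Finset.prod_mul_distrib]
  refine Finset.prod_congr rfl fun d _ => ?_
  by_cases h : d ∈ D <;> by_cases h' : d ∈ D'
  · have := integral_add_id_sq_gaussianReal (a d) 1
    simp only [h, h', if_true, ← sq, hD d h, if_false, this]
    simp [h, h', add_comm]
  · simp [h, h', integral_add_id_gaussianReal]
  · simp [h, h', integral_add_id_gaussianReal]
  · simp [h, h']

/-! ### The spiked model -/

/-- The signal-to-noise ratio of the matrix selected by a decoration. -/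
def coef (lam mu : ℝ) (b : Bool) : ℝ := cond b lam mu

/-- The entry of a pair of matrices at a decorated edge. -/
def entry {n : ℕ} (M : MatrixPair n) (d : Sym2 (Fin n) × Bool) : ℝ :=
  cond d.2 (M.1 d.1.inf d.1.sup) (M.2 d.1.inf d.1.sup)

/-- The mean of the entry `d`, given the spikes. -/
noncomputable def signal (lam mu : ℝ) {n : ℕ} (x : Fin n → ℝ × ℝ) (d : Sym2 (Fin n) × Bool) : ℝ :=
  coef lam mu d.2 / √(n : ℝ) * (coord d.2 (x d.1.inf) * coord d.2 (x d.1.sup))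

/-- The joint law of the spikes and of the noise. -/
noncomputable def sampleLaw (p : Measure (ℝ × ℝ)) (n : ℕ) :
    Measure ((Fin n → ℝ × ℝ) × ((Sym2 (Fin n) → ℝ) × (Sym2 (Fin n) → ℝ))) :=
  (Measure.pi fun _ : Fin n => p).prod ((wignerEntryLaw n).prod (wignerEntryLaw n))

instance (p : Measure (ℝ × ℝ)) [IsProbabilityMeasure p] (n : ℕ) :
    IsProbabilityMeasure (sampleLaw p n) := by
  unfold sampleLaw
  infer_instance

/-- The observed matrices as a function of the spikes and of the noise. -/
noncomputable def sampleMap (lam mu : ℝ) (n : ℕ)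
    (ω : (Fin n → ℝ × ℝ) × ((Sym2 (Fin n) → ℝ) × (Sym2 (Fin n) → ℝ))) : MatrixPair n :=
  ((lam / √(n : ℝ)) • Matrix.vecMulVec (fun i => (ω.1 i).1) (fun i => (ω.1 i).1) +
      Matrix.of fun i j => ω.2.1 s(i, j),
    (mu / √(n : ℝ)) • Matrix.vecMulVec (fun i => (ω.1 i).2) (fun i => (ω.1 i).2) +
      Matrix.of fun i j => ω.2.2 s(i, j))

theorem measurable_of_entries {α : Type*} [MeasurableSpace α] {n : ℕ}
    {f : α → Matrix (Fin n) (Fin n) ℝ} (h : ∀ i j, Measurable fun a => f a i j) :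
    Measurable f :=
  measurable_pi_iff.2 fun i => measurable_pi_iff.2 fun j => h i j

theorem measurable_apply_apply {n : ℕ} (i j : Fin n) :
    Measurable fun M : Matrix (Fin n) (Fin n) ℝ => M i j :=
  (measurable_pi_apply j).comp (measurable_pi_apply (X := fun _ : Fin n => Fin n → ℝ) i)

theorem measurable_entry {n : ℕ} (d : Sym2 (Fin n) × Bool) :
    Measurable fun M : MatrixPair n => entry M d := by
  obtain ⟨e, b⟩ := d
  cases b
  · exact (measurable_apply_apply _ _).comp measurable_snd
  · exact (measurable_apply_apply _ _).comp measurable_fst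

theorem measurable_sampleMap (lam mu : ℝ) (n : ℕ) : Measurable (sampleMap lam mu n) := by
  refine Measurable.prodMk (measurable_of_entries fun i j => ?_)
    (measurable_of_entries fun i j => ?_)
  · simp only [Matrix.add_apply, Matrix.smul_apply, Matrix.vecMulVec_apply, Matrix.of_apply,
      smul_eq_mul]
    fun_prop
  · simp only [Matrix.add_apply, Matrix.smul_apply, Matrix.vecMulVec_apply, Matrix.of_apply,
      smul_eq_mul]
    fun_prop

theorem spikedLaw_eq_map (lam mu : ℝ) (p : Measure (ℝ × ℝ)) [IsProbabilityMeasure p] (n : ℕ) :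
    spikedLaw lam mu p n = (sampleLaw p n).map (sampleMap lam mu n) := by
  have hf : Measurable fun g : Sym2 (Fin n) → ℝ =>
      (Matrix.of fun i j => g s(i, j) : Matrix (Fin n) (Fin n) ℝ) :=
    measurable_of_entries fun i j => by
      simp only [Matrix.of_apply]
      fun_prop
  have hnull : nullLaw n = ((wignerEntryLaw n).prod (wignerEntryLaw n)).map
      (Prod.map (fun g : Sym2 (Fin n) → ℝ => (Matrix.of fun i j => g s(i, j)))
        fun g : Sym2 (Fin n) → ℝ => (Matrix.of fun i j => g s(i, j))) :=
    Measure.map_prod_map _ _ hf hf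
  unfold spikedLaw sampleLaw
  rw [hnull]
  have h2 := Measure.map_prod_map (Measure.pi fun _ : Fin n => p)
    ((wignerEntryLaw n).prod (wignerEntryLaw n)) measurable_id (hf.prodMap hf)
  rw [Measure.map_id] at h2
  rw [h2, Measure.map_map ?_ (measurable_id.prodMap (hf.prodMap hf))]
  · rfl
  · refine Measurable.prodMk (measurable_of_entries fun i j => ?_)
      (measurable_of_entries fun i j => ?_)
    · simp only [Matrix.add_apply, Matrix.smul_apply, Matrix.vecMulVec_apply, smul_eq_mul]
      have h3 : Measurable fun c : (Fin n → ℝ × ℝ) × MatrixPair n => c.2.1 i j :=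
        (measurable_apply_apply i j).comp (measurable_fst.comp measurable_snd)
      fun_prop
    · simp only [Matrix.add_apply, Matrix.smul_apply, Matrix.vecMulVec_apply, smul_eq_mul]
      have h3 : Measurable fun c : (Fin n → ℝ × ℝ) × MatrixPair n => c.2.2 i j :=
        (measurable_apply_apply i j).comp (measurable_snd.comp measurable_snd)
      fun_prop

theorem spikedLaw_zero (p : Measure (ℝ × ℝ)) [IsProbabilityMeasure p] (n : ℕ) :
    spikedLaw 0 0 p n = nullLaw n := by
  have h1 : IsProbabilityMeasure (wignerLaw n) := by
    have := (inferInstance : IsProbabilityMeasure (wignerEntryLaw n))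
    exact Measure.isProbabilityMeasure_map (measurable_of_entries fun i j => by
      simp only [Matrix.of_apply]
      fun_prop).aemeasurable
  have h2 : IsProbabilityMeasure (nullLaw n) := by
    unfold nullLaw
    infer_instance
  unfold spikedLaw
  simp only [zero_div, zero_smul, zero_add, Prod.mk.eta]
  have h3 := Measure.map_snd_prod (μ := Measure.pi fun _ : Fin n => p) (ν := nullLaw n)
  simp only [h3, measure_univ, one_smul]

theorem inf_sup_eq {n : ℕ} (e : Sym2 (Fin n)) : s(e.inf, e.sup) = e := by
  induction e with
  | _ i j =>
    rcases le_total i j with h | h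
    · simp [h]
    · simp [h, Sym2.eq_swap]

theorem entry_sampleMap (lam mu : ℝ) {n : ℕ}
    (ω : (Fin n → ℝ × ℝ) × ((Sym2 (Fin n) → ℝ) × (Sym2 (Fin n) → ℝ)))
    (d : Sym2 (Fin n) × Bool) :
    entry (sampleMap lam mu n ω) d = signal lam mu ω.1 d + noise ω.2 d := by
  obtain ⟨e, b⟩ := d
  cases b <;>
  simp [entry, sampleMap, signal, noise, coef, coord, Matrix.vecMulVec_apply, inf_sup_eq]

theorem signal_edge (lam mu : ℝ) {n k : ℕ} (x : Fin n → ℝ × ℝ) (q : LabeledCycle k (Fin n))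
    (i : Fin (k + 3)) :
    signal lam mu x (q.edge i) = coef lam mu (q.2 i) / √(n : ℝ) *
      (coord (q.2 i) (x (q.1 i)) * coord (q.2 i) (x (q.1 (i + 1)))) := by
  simp only [signal, LabeledCycle.edge, Sym2.inf_mk, Sym2.sup_mk]
  rcases le_total (q.1 i) (q.1 (i + 1)) with h | h
  · simp [h]
  · simp [h, mul_comm]

theorem abs_signal_le {lam mu : ℝ} (hlam : |lam| ≤ 1) (hmu : |mu| ≤ 1) {n : ℕ}
    (x : Fin n → ℝ × ℝ) (d : Sym2 (Fin n) × Bool) :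
    |signal lam mu x d| ≤ 1 / √(n : ℝ) * (|coord d.2 (x d.1.inf)| * |coord d.2 (x d.1.sup)|) := by
  have h : |coef lam mu d.2| ≤ 1 := by cases d.2 <;> simpa [coef]
  rw [signal, abs_mul, abs_mul, abs_div, abs_of_nonneg (Real.sqrt_nonneg _)]
  gcongr

/-- The product of the envelopes at the endpoints of an edge. -/
def edgeEnvelope {n : ℕ} (x : Fin n → ℝ × ℝ) (d : Sym2 (Fin n) × Bool) : ℝ :=
  envelope (x d.1.inf) * envelope (x d.1.sup)

theorem one_le_edgeEnvelope {n : ℕ} (x : Fin n → ℝ × ℝ) (d : Sym2 (Fin n) × Bool) :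
    1 ≤ edgeEnvelope x d := one_le_mul_of_one_le_of_one_le (one_le_envelope _) (one_le_envelope _)

theorem abs_signal_le_edgeEnvelope {lam mu : ℝ} (hlam : |lam| ≤ 1) (hmu : |mu| ≤ 1) {n : ℕ}
    (x : Fin n → ℝ × ℝ) (d : Sym2 (Fin n) × Bool) :
    |signal lam mu x d| ≤ 1 / √(n : ℝ) * edgeEnvelope x d := by
  refine (abs_signal_le hlam hmu x d).trans ?_
  unfold edgeEnvelope
  gcongr
  · exact envelope_nonneg _
  · exact abs_coord_le _ _
  · exact abs_coord_le _ _

theorem one_add_mul_signal_sq_le {lam mu : ℝ} (hlam : |lam| ≤ 1) (hmu : |mu| ≤ 1) {n : ℕ}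
    (x : Fin n → ℝ × ℝ) (d : Sym2 (Fin n) × Bool) :
    1 + n * signal lam mu x d ^ 2 ≤ edgeEnvelope x d ^ 2 := by
  have h1 := abs_signal_le hlam hmu x d
  have h2 : n * signal lam mu x d ^ 2 ≤ coord d.2 (x d.1.inf) ^ 2 * coord d.2 (x d.1.sup) ^ 2 := by
    have h3 : |signal lam mu x d| ^ 2 ≤
        (1 / √(n : ℝ) * (|coord d.2 (x d.1.inf)| * |coord d.2 (x d.1.sup)|)) ^ 2 := by gcongr
    simp only [mul_pow, sq_abs, div_pow, Real.sq_sqrt (Nat.cast_nonneg n)] at h3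
    have h4 : (n : ℝ) * (1 ^ 2 / n) ≤ 1 := by
      rcases eq_or_ne (n : ℝ) 0 with h | h
      · simp [h]
      · field_simp
        simp
    calc (n : ℝ) * signal lam mu x d ^ 2
        ≤ n * (1 ^ 2 / n * (coord d.2 (x d.1.inf) ^ 2 * coord d.2 (x d.1.sup) ^ 2)) := by gcongr
      _ = n * (1 ^ 2 / n) * (coord d.2 (x d.1.inf) ^ 2 * coord d.2 (x d.1.sup) ^ 2) := by ring
      _ ≤ _ := mul_le_of_le_one_left (by positivity) h4
  have h5 := one_add_coord_sq_le d.2 (x d.1.inf)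
  have h6 := one_add_coord_sq_le d.2 (x d.1.sup)
  have h7 : (1 + coord d.2 (x d.1.inf) ^ 2) * (1 + coord d.2 (x d.1.sup) ^ 2) ≤
      envelope (x d.1.inf) ^ 2 * envelope (x d.1.sup) ^ 2 := by gcongr
  rw [edgeEnvelope, mul_pow]
  nlinarith [sq_nonneg (coord d.2 (x d.1.inf)), sq_nonneg (coord d.2 (x d.1.sup))]

theorem one_add_signal_sq_le {lam mu : ℝ} (hlam : |lam| ≤ 1) (hmu : |mu| ≤ 1) {n : ℕ}
    (x : Fin n → ℝ × ℝ) (d : Sym2 (Fin n) × Bool) :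
    1 + signal lam mu x d ^ 2 ≤ edgeEnvelope x d ^ 2 := by
  refine le_trans ?_ (one_add_mul_signal_sq_le hlam hmu x d)
  have hn : (1 : ℝ) ≤ n := by
    have : 0 < n := (d.1.inf).pos
    exact_mod_cast this
  nlinarith [sq_nonneg (signal lam mu x d)]

theorem prod_edgeEnvelope {n k : ℕ} (x : Fin n → ℝ × ℝ) (q : LabeledCycle k (Fin n)) :
    ∏ d ∈ q.edges, edgeEnvelope x d = ∏ i, envelope (x (q.1 i)) ^ 2 := by
  rw [LabeledCycle.prod_edges]
  have h : ∀ i, edgeEnvelope x (q.edge i) = envelope (x (q.1 i)) * envelope (x (q.1 (i + 1))) := by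
    intro i
    simp only [edgeEnvelope, LabeledCycle.edge, Sym2.inf_mk, Sym2.sup_mk]
    rcases le_total (q.1 i) (q.1 (i + 1)) with h | h
    · simp [h]
    · simp [h, mul_comm]
  simp only [h, Finset.prod_mul_distrib, sq]
  congr 1
  exact Equiv.prod_comp (Equiv.addRight (1 : Fin (k + 3))) fun i => envelope (x (q.1 i))

/-! ### Moments of products along cycles -/

/-- The product of the entries along a labeled cycle. -/
def cycleProd {k n : ℕ} (q : LabeledCycle k (Fin n)) (M : MatrixPair n) : ℝ :=
  ∏ i, entry M (q.edge i)

/-- The weight of a cycle whose edges are decorated by `s`. -/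
def labelWeight (lam mu rho : ℝ) {k : ℕ} (s : Fin (k + 3) → Bool) : ℝ :=
  ∏ i, (coef lam mu (s i) * if s i = s (i + 1) then 1 else rho)

/-- The expectation of a product of two products along cycles, given the spikes. -/
noncomputable def condSecond (lam mu : ℝ) {n : ℕ} (D D' : Finset (Sym2 (Fin n) × Bool))
    (x : Fin n → ℝ × ℝ) : ℝ :=
  (∏ d ∈ D ∩ D', (1 + signal lam mu x d ^ 2)) *
    ((∏ d ∈ D \ D', signal lam mu x d) * ∏ d ∈ D' \ D, signal lam mu x d)

section

variable {k n : ℕ}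

theorem measurable_cycleProd (q : LabeledCycle k (Fin n)) : Measurable (cycleProd q) :=
  Finset.measurable_fun_prod _ fun i _ => measurable_entry (q.edge i)

theorem cycleProd_sampleMap (lam mu : ℝ) (q : LabeledCycle k (Fin n))
    (ω : (Fin n → ℝ × ℝ) × ((Sym2 (Fin n) → ℝ) × (Sym2 (Fin n) → ℝ))) :
    cycleProd q (sampleMap lam mu n ω) =
      ∏ d ∈ q.edges, (signal lam mu ω.1 d + noise ω.2 d) := by
  simp only [cycleProd, LabeledCycle.prod_edges, entry_sampleMap]

theorem prod_envelope_le (q : LabeledCycle k (Fin n)) (x : Fin n → ℝ × ℝ) :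
    ∏ i, envelope (x (q.1 i)) ^ 4 ≤ ∏ v, envelope (x v) ^ 4 := by
  rw [← Finset.prod_map Finset.univ q.1 fun v => envelope (x v) ^ 4]
  exact Finset.prod_le_prod_of_subset_of_one_le (Finset.subset_univ _)
    (fun v _ => pow_nonneg (envelope_nonneg _) 4) fun v _ _ => one_le_pow₀ (one_le_envelope _)

theorem prod_edgeEnvelope_sq (x : Fin n → ℝ × ℝ) (q : LabeledCycle k (Fin n)) :
    ∏ d ∈ q.edges, edgeEnvelope x d ^ 2 = ∏ i, envelope (x (q.1 i)) ^ 4 := by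
  rw [Finset.prod_pow, prod_edgeEnvelope, ← Finset.prod_pow]
  simp only [← pow_mul]

variable {p : Measure (ℝ × ℝ)} {rho C lam mu : ℝ}

theorem integrable_prod_envelope (hp : IsCorrelatedPrior p rho C) (q : LabeledCycle k (Fin n)) :
    Integrable (fun x : Fin n → ℝ × ℝ => ∏ i, envelope (x (q.1 i)) ^ 4)
      (Measure.pi fun _ : Fin n => p) := by
  have := hp.prob
  have h : Integrable (fun x : Fin n → ℝ × ℝ => ∏ v, envelope (x v) ^ 4)
      (Measure.pi fun _ : Fin n => p) :=
    Integrable.fintype_prod fun _ => hp.integrable_envelope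
  refine h.mono' ?_ (ae_of_all _ fun x => ?_)
  · have := measurable_envelope
    exact Measurable.aestronglyMeasurable (by fun_prop)
  · rw [Real.norm_of_nonneg (Finset.prod_nonneg fun i _ => pow_nonneg (envelope_nonneg _) _)]
    exact prod_envelope_le q x

theorem integral_prod_envelope (hp : IsCorrelatedPrior p rho C) (q : LabeledCycle k (Fin n)) :
    ∫ x, ∏ i, envelope (x (q.1 i)) ^ 4 ∂(Measure.pi fun _ : Fin n => p) =
      (∫ z, envelope z ^ 4 ∂p) ^ (k + 3) := by
  have := hp.prob
  rw [integral_prod_comp_pi p q.1.injective (F := fun _ z => envelope z ^ 4)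
    fun _ => measurable_envelope.pow_const 4]
  simp

theorem memLp_cycleProd_sampleMap (hp : IsCorrelatedPrior p rho C) (hlam : |lam| ≤ 1)
    (hmu : |mu| ≤ 1) (q : LabeledCycle k (Fin n)) :
    MemLp (fun ω => cycleProd q (sampleMap lam mu n ω)) 2 (sampleLaw p n) := by
  have := hp.prob
  have hm : Measurable fun ω => cycleProd q (sampleMap lam mu n ω) :=
    (measurable_cycleProd q).comp (measurable_sampleMap lam mu n)
  refine (memLp_two_iff_integrable_sq hm.aestronglyMeasurable).2 ?_
  have h1 : Integrable (fun g => ∏ d, (fun _ z => 1 + z ^ 2) d (noise g d))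
      ((wignerEntryLaw n).prod (wignerEntryLaw n)) :=
    integrable_prod_noise (fun _ z => 1 + z ^ 2) fun d =>
      (integrable_const 1).add (integrable_sq_gaussianReal _)
  have h2 := ((integrable_prod_envelope hp q).mul_prod h1).const_mul (2 ^ (k + 3))
  refine h2.mono' (hm.pow_const 2).aestronglyMeasurable (ae_of_all _ fun ω => ?_)
  rw [Real.norm_of_nonneg (sq_nonneg _), cycleProd_sampleMap, ← Finset.prod_pow]
  calc ∏ d ∈ q.edges, (signal lam mu ω.1 d + noise ω.2 d) ^ 2
      ≤ ∏ d ∈ q.edges, 2 * (edgeEnvelope ω.1 d ^ 2 * (1 + noise ω.2 d ^ 2)) := by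
        refine Finset.prod_le_prod (fun d _ => sq_nonneg _) fun d _ => ?_
        have h3 := one_add_signal_sq_le hlam hmu ω.1 d
        have h4 : (1 + signal lam mu ω.1 d ^ 2) * (1 + noise ω.2 d ^ 2) ≤
          edgeEnvelope ω.1 d ^ 2 * (1 + noise ω.2 d ^ 2) := by gcongr
        nlinarith [sq_nonneg (signal lam mu ω.1 d - noise ω.2 d),
          sq_nonneg (signal lam mu ω.1 d * noise ω.2 d)]
    _ = 2 ^ (k + 3) * ((∏ i, envelope (ω.1 (q.1 i)) ^ 4) *
          ∏ d ∈ q.edges, (1 + noise ω.2 d ^ 2)) := by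
        rw [Finset.prod_mul_distrib, Finset.prod_mul_distrib, prod_edgeEnvelope_sq,
          Finset.prod_const, LabeledCycle.card_edges]
    _ ≤ _ := by
        have h5 : ∏ d ∈ q.edges, (1 + noise ω.2 d ^ 2) ≤ ∏ d, (1 + noise ω.2 d ^ 2) :=
          Finset.prod_le_prod_of_subset_of_one_le (Finset.subset_univ _)
            (fun d _ => by positivity) fun d _ _ => by nlinarith [sq_nonneg (noise ω.2 d)]
        have h6 : 0 ≤ ∏ i, envelope (ω.1 (q.1 i)) ^ 4 :=
          Finset.prod_nonneg fun i _ => pow_nonneg (envelope_nonneg _) 4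
        gcongr

theorem memLp_cycleProd (hp : IsCorrelatedPrior p rho C) (hlam : |lam| ≤ 1)
    (hmu : |mu| ≤ 1) (q : LabeledCycle k (Fin n)) :
    MemLp (cycleProd q) 2 (spikedLaw lam mu p n) := by
  have := hp.prob
  rw [spikedLaw_eq_map]
  exact (memLp_map_measure_iff (measurable_cycleProd q).aestronglyMeasurable
    (measurable_sampleMap lam mu n).aemeasurable).2 (memLp_cycleProd_sampleMap hp hlam hmu q)

theorem integral_cycleProd_mul_eq (hp : IsCorrelatedPrior p rho C) (hlam : |lam| ≤ 1)
    (hmu : |mu| ≤ 1) (q q' : LabeledCycle k (Fin n)) :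
    ∫ M, cycleProd q M * cycleProd q' M ∂(spikedLaw lam mu p n) =
      ∫ x, condSecond lam mu q.edges q'.edges x ∂(Measure.pi fun _ : Fin n => p) := by
  have := hp.prob
  have hint : Integrable (fun ω => cycleProd q (sampleMap lam mu n ω) *
      cycleProd q' (sampleMap lam mu n ω)) (sampleLaw p n) :=
    (memLp_cycleProd_sampleMap hp hlam hmu q).integrable_mul
      (memLp_cycleProd_sampleMap hp hlam hmu q')
  rw [spikedLaw_eq_map, integral_map (measurable_sampleMap lam mu n).aemeasurable
    (Measurable.aestronglyMeasurable (by
      have := measurable_cycleProd q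
      have := measurable_cycleProd q'
      fun_prop))]
  unfold sampleLaw at hint ⊢
  rw [integral_prod _ hint]
  refine integral_congr_ae (ae_of_all _ fun x => ?_)
  simp only [cycleProd_sampleMap]
  refine integral_prod_add_noise (signal lam mu x) fun d hd => ?_
  obtain ⟨i, rfl⟩ := LabeledCycle.mem_edges.1 hd
  exact q.not_isDiag_edge i

theorem integral_cycleProd_eq (hp : IsCorrelatedPrior p rho C) (hlam : |lam| ≤ 1)
    (hmu : |mu| ≤ 1) (q : LabeledCycle k (Fin n)) :
    ∫ M, cycleProd q M ∂(spikedLaw lam mu p n) =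
      ∫ x, ∏ d ∈ q.edges, signal lam mu x d ∂(Measure.pi fun _ : Fin n => p) := by
  have := hp.prob
  have hint : Integrable (fun ω => cycleProd q (sampleMap lam mu n ω)) (sampleLaw p n) :=
    (memLp_cycleProd_sampleMap hp hlam hmu q).integrable (by norm_num)
  rw [spikedLaw_eq_map, integral_map (measurable_sampleMap lam mu n).aemeasurable
    (measurable_cycleProd q).aestronglyMeasurable]
  unfold sampleLaw at hint ⊢
  rw [integral_prod _ hint]
  refine integral_congr_ae (ae_of_all _ fun x => ?_)
  simp only [cycleProd_sampleMap]
  have h := integral_prod_add_noise (D := q.edges) (D' := ∅) (signal lam mu x) fun d hd => by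
    obtain ⟨i, rfl⟩ := LabeledCycle.mem_edges.1 hd
    exact q.not_isDiag_edge i
  simpa using h

theorem prod_signal_edges (x : Fin n → ℝ × ℝ) (q : LabeledCycle k (Fin n)) :
    ∏ d ∈ q.edges, signal lam mu x d = (∏ i, coef lam mu (q.2 i) / √(n : ℝ)) *
      ∏ i, (coord (q.2 i) (x (q.1 (i + 1))) * coord (q.2 (i + 1)) (x (q.1 (i + 1)))) := by
  have h := Equiv.prod_comp (Equiv.addRight (1 : Fin (k + 3)))
    fun i => coord (q.2 i) (x (q.1 i))
  simp only [Equiv.coe_addRight] at h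
  simp only [LabeledCycle.prod_edges, signal_edge, Finset.prod_mul_distrib, h]
  ring

theorem succ_injective (q : LabeledCycle k (Fin n)) :
    Function.Injective fun i => q.1 (i + 1) :=
  q.1.injective.comp (add_left_injective 1)

theorem labelWeight_eq (hp : IsCorrelatedPrior p rho C) (s : Fin (k + 3) → Bool) :
    (∏ i, coef lam mu (s i) / √(n : ℝ)) *
      ∏ i, ∫ z, coord (s i) z * coord (s (i + 1)) z ∂p =
      (1 / √(n : ℝ)) ^ (k + 3) * labelWeight lam mu rho s := by
  simp only [hp.integral_coord_mul, labelWeight, Finset.prod_mul_distrib, Finset.prod_div_distrib,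
    Finset.prod_const, Finset.card_univ, Fintype.card_fin]
  ring

/-- The mean of the product along a cycle. -/
theorem integral_cycleProd (hp : IsCorrelatedPrior p rho C) (hlam : |lam| ≤ 1)
    (hmu : |mu| ≤ 1) (q : LabeledCycle k (Fin n)) :
    ∫ M, cycleProd q M ∂(spikedLaw lam mu p n) =
      (1 / √(n : ℝ)) ^ (k + 3) * labelWeight lam mu rho q.2 := by
  have := hp.prob
  rw [integral_cycleProd_eq hp hlam hmu]
  simp only [prod_signal_edges]
  rw [integral_const_mul, integral_prod_comp_pi p (succ_injective q)
    (F := fun i z => coord (q.2 i) z * coord (q.2 (i + 1)) z)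
    fun i => (measurable_coord _).mul (measurable_coord _), labelWeight_eq hp]

/-- Products along vertex-disjoint cycles are uncorrelated. -/
theorem integral_cycleProd_mul_of_disjoint (hp : IsCorrelatedPrior p rho C) (hlam : |lam| ≤ 1)
    (hmu : |mu| ≤ 1) {q q' : LabeledCycle k (Fin n)} (h : LabeledCycle.overlap q q' = 0) :
    ∫ M, cycleProd q M * cycleProd q' M ∂(spikedLaw lam mu p n) =
      (∫ M, cycleProd q M ∂(spikedLaw lam mu p n)) *
        ∫ M, cycleProd q' M ∂(spikedLaw lam mu p n) := by
  have := hp.prob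
  have hne := LabeledCycle.overlap_eq_zero h
  have hdis : Disjoint q.edges q'.edges := by
    rw [Finset.disjoint_left]
    intro d hd hd'
    obtain ⟨i, rfl⟩ := LabeledCycle.mem_edges.1 hd
    obtain ⟨j, hj⟩ := LabeledCycle.mem_edges.1 hd'
    have hj1 := congrArg Prod.fst hj
    simp only [LabeledCycle.edge, Sym2.eq_iff] at hj1
    rcases hj1 with hj1 | hj1
    · exact hne _ _ hj1.1.symm
    · exact hne _ _ hj1.1.symm
  rw [integral_cycleProd_mul_eq hp hlam hmu, integral_cycleProd hp hlam hmu,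
    integral_cycleProd hp hlam hmu]
  simp only [condSecond, Finset.disjoint_iff_inter_eq_empty.1 hdis, Finset.prod_empty, one_mul,
    Finset.sdiff_eq_self_of_disjoint hdis, Finset.sdiff_eq_self_of_disjoint hdis.symm,
    prod_signal_edges]
  have hθ : Function.Injective (Sum.elim (fun i => q.1 (i + 1)) fun i => q'.1 (i + 1)) :=
    (succ_injective q).sumElim (succ_injective q') fun i j => hne _ _
  have h1 := integral_prod_comp_pi p hθ
    (F := Sum.elim (fun i z => coord (q.2 i) z * coord (q.2 (i + 1)) z)
      fun i z => coord (q'.2 i) z * coord (q'.2 (i + 1)) z)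
    (fun i => by
      cases i
      · exact (measurable_coord _).mul (measurable_coord _)
      · exact (measurable_coord _).mul (measurable_coord _))
  simp only [Fintype.prod_sum_type, Sum.elim_inl, Sum.elim_inr] at h1
  rw [← labelWeight_eq hp, ← labelWeight_eq hp, mul_mul_mul_comm, ← h1, ← integral_const_mul]
  refine integral_congr_ae (ae_of_all _ fun x => ?_)
  dsimp only
  ring

theorem abs_condSecond_le (hlam : |lam| ≤ 1) (hmu : |mu| ≤ 1) (q q' : LabeledCycle k (Fin n))
    (x : Fin n → ℝ × ℝ) :
    |condSecond lam mu q.edges q'.edges x| ≤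
      (1 / (n : ℝ)) ^ (k + 3 - (q.edges ∩ q'.edges).card) *
        (2⁻¹ * ((∏ i, envelope (x (q.1 i)) ^ 4) + ∏ i, envelope (x (q'.1 i)) ^ 4)) := by
  set D := q.edges
  set D' := q'.edges
  have h0 : ∀ d, 0 ≤ edgeEnvelope x d := fun d => zero_le_one.trans (one_le_edgeEnvelope x d)
  have h1 : ∀ A : Finset (Sym2 (Fin n) × Bool), |∏ d ∈ A, signal lam mu x d| ≤
      (1 / √(n : ℝ)) ^ A.card * ∏ d ∈ A, edgeEnvelope x d := by
    intro A
    rw [Finset.abs_prod, ← Finset.prod_const, ← Finset.prod_mul_distrib]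
    exact Finset.prod_le_prod (fun _ _ => abs_nonneg _) fun d _ =>
      abs_signal_le_edgeEnvelope hlam hmu x d
  have h2 : |∏ d ∈ D ∩ D', (1 + signal lam mu x d ^ 2)| ≤
      (∏ d ∈ D ∩ D', edgeEnvelope x d) * ∏ d ∈ D' ∩ D, edgeEnvelope x d := by
    rw [Finset.inter_comm D' D, ← Finset.prod_mul_distrib, Finset.abs_prod]
    refine Finset.prod_le_prod (fun _ _ => abs_nonneg _) fun d _ => ?_
    rw [abs_of_nonneg (by positivity), ← sq]
    exact one_add_signal_sq_le hlam hmu x d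
  have hc1 : (D \ D').card = k + 3 - (D ∩ D').card := by
    rw [Finset.card_sdiff, Finset.inter_comm, LabeledCycle.card_edges]
  have hc2 : (D' \ D).card = k + 3 - (D ∩ D').card := by
    rw [Finset.card_sdiff, LabeledCycle.card_edges]
  have hn : (1 / √(n : ℝ)) ^ (D \ D').card * (1 / √(n : ℝ)) ^ (D' \ D).card =
      (1 / (n : ℝ)) ^ (k + 3 - (D ∩ D').card) := by
    rw [hc1, hc2, ← mul_pow, div_mul_div_comm, Real.mul_self_sqrt (Nat.cast_nonneg n), one_mul]
  have e1 := Finset.prod_inter_mul_prod_sdiff D D' (edgeEnvelope x)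
  have e2 := Finset.prod_inter_mul_prod_sdiff D' D (edgeEnvelope x)
  have h3 : |condSecond lam mu D D' x| ≤ (1 / (n : ℝ)) ^ (k + 3 - (D ∩ D').card) *
      ((∏ d ∈ D, edgeEnvelope x d) * ∏ d ∈ D', edgeEnvelope x d) := by
    rw [condSecond, abs_mul, abs_mul]
    calc _ ≤ ((∏ d ∈ D ∩ D', edgeEnvelope x d) * ∏ d ∈ D' ∩ D, edgeEnvelope x d) *
          (((1 / √(n : ℝ)) ^ (D \ D').card * ∏ d ∈ D \ D', edgeEnvelope x d) *
            ((1 / √(n : ℝ)) ^ (D' \ D).card * ∏ d ∈ D' \ D, edgeEnvelope x d)) := by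
          gcongr
          · exact mul_nonneg (Finset.prod_nonneg fun d _ => h0 d)
              (Finset.prod_nonneg fun d _ => h0 d)
          · exact mul_nonneg (by positivity) (Finset.prod_nonneg fun d _ => h0 d)
          · exact h1 _
          · exact h1 _
      _ = _ := by
          rw [← hn, ← e1, ← e2]
          ring
  refine h3.trans ?_
  refine mul_le_mul_of_nonneg_left ?_ (by positivity)
  rw [prod_edgeEnvelope, prod_edgeEnvelope]
  have e3 : ∀ r : LabeledCycle k (Fin n),
      ∏ i, envelope (x (r.1 i)) ^ 4 = (∏ i, envelope (x (r.1 i)) ^ 2) ^ 2 := by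
    intro r
    rw [← Finset.prod_pow]
    simp only [← pow_mul]
  rw [e3, e3]
  nlinarith [sq_nonneg ((∏ i, envelope (x (q.1 i)) ^ 2) - ∏ i, envelope (x (q'.1 i)) ^ 2)]

theorem integral_cycleProd_mul_le (hp : IsCorrelatedPrior p rho C) (hlam : |lam| ≤ 1)
    (hmu : |mu| ≤ 1) (q q' : LabeledCycle k (Fin n)) :
    ∫ M, cycleProd q M * cycleProd q' M ∂(spikedLaw lam mu p n) ≤
      (1 / (n : ℝ)) ^ (k + 3 - (q.edges ∩ q'.edges).card) *
        (∫ z, envelope z ^ 4 ∂p) ^ (k + 3) := by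
  rw [integral_cycleProd_mul_eq hp hlam hmu]
  have hi := ((((integrable_prod_envelope hp q).add
    (integrable_prod_envelope hp q')).const_mul 2⁻¹).const_mul
      ((1 / (n : ℝ)) ^ (k + 3 - (q.edges ∩ q'.edges).card)))
  have h := norm_integral_le_of_norm_le hi (ae_of_all _ fun x => by
    rw [Real.norm_eq_abs]
    exact abs_condSecond_le hlam hmu q q' x)
  refine (Real.le_norm_self _).trans (h.trans (le_of_eq ?_))
  simp only [Pi.add_apply]
  rw [integral_const_mul, integral_const_mul, integral_add (integrable_prod_envelope hp q)
    (integrable_prod_envelope hp q'), integral_prod_envelope hp, integral_prod_envelope hp]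
  ring

theorem prod_one_add_mul_le {ι : Type*} (s : Finset ι) {a : ι → ℝ} (ha : ∀ i, 0 ≤ a i) {t : ℝ}
    (ht0 : 0 ≤ t) (ht1 : t ≤ 1) :
    ∏ i ∈ s, (1 + t * a i) ≤ 1 + t * (∏ i ∈ s, (1 + a i) - 1) := by
  classical
  induction s using Finset.induction_on with
  | empty => simp
  | insert i s hi ih =>
    rw [Finset.prod_insert hi, Finset.prod_insert hi]
    have h1 : 1 ≤ ∏ i ∈ s, (1 + a i) := Finset.one_le_prod fun j _ => by linarith [ha j]
    have h2 : 0 ≤ 1 + t * a i := by have := ha i; positivity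
    refine (mul_le_mul_of_nonneg_left ih h2).trans ?_
    have h3 : 0 ≤ t * a i * (∏ i ∈ s, (1 + a i) - 1) :=
      mul_nonneg (mul_nonneg ht0 (ha i)) (by linarith)
    nlinarith

theorem integral_cycleProd_mul_le_of_edges_eq (hp : IsCorrelatedPrior p rho C) (hlam : |lam| ≤ 1)
    (hmu : |mu| ≤ 1) (hn : 0 < n) {q q' : LabeledCycle k (Fin n)} (h : q.edges = q'.edges) :
    ∫ M, cycleProd q M * cycleProd q' M ∂(spikedLaw lam mu p n) ≤
      1 + 1 / (n : ℝ) * (∫ z, envelope z ^ 4 ∂p) ^ (k + 3) := by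
  have := hp.prob
  have hn1 : (1 : ℝ) ≤ n := by exact_mod_cast hn
  rw [integral_cycleProd_mul_eq hp hlam hmu, ← h]
  simp only [condSecond, Finset.inter_self, Finset.sdiff_self, Finset.prod_empty, mul_one]
  have hi := ((integrable_prod_envelope hp q).const_mul (1 / (n : ℝ)))
  have hi2 := (integrable_const (μ := Measure.pi fun _ : Fin n => p) (1 : ℝ)).add hi
  refine (integral_mono_of_nonneg (ae_of_all _ fun x => ?_) hi2 (ae_of_all _ fun x => ?_)).trans
    (le_of_eq ?_)
  · exact Finset.prod_nonneg fun d _ => by positivity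
  · have h1 := prod_one_add_mul_le q.edges (a := fun d => n * signal lam mu x d ^ 2)
      (fun d => by positivity) (t := 1 / (n : ℝ)) (by positivity)
      (by rw [div_le_one (by linarith)]; exact hn1)
    have h2 : ∀ d, 1 / (n : ℝ) * (n * signal lam mu x d ^ 2) = signal lam mu x d ^ 2 := by
      intro d
      field_simp
    simp only [h2] at h1
    refine h1.trans ?_
    have h3 : ∏ d ∈ q.edges, (1 + n * signal lam mu x d ^ 2) ≤
        ∏ i, envelope (x (q.1 i)) ^ 4 := by
      rw [← prod_edgeEnvelope_sq]
      exact Finset.prod_le_prod (fun d _ => by positivity) fun d _ =>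
        one_add_mul_signal_sq_le hlam hmu x d
    simp only [Pi.add_apply]
    gcongr
    linarith
  · simp only [Pi.add_apply]
    rw [integral_add (integrable_const _) hi, integral_const_mul, integral_prod_envelope hp]
    simp

end

/-! ### Growth of the total squared weight -/

/-- Weighted paths grow at the rate of a subinvariant vector of the transfer matrix. -/
theorem pow_mul_sum_le_sum_path {α : Type*} [Fintype α] {A : α → α → ℝ} (hA : ∀ a b, 0 ≤ A a b)
    {v : α → ℝ} {r : ℝ} (hr : 0 ≤ r) (hv : ∀ a, r * v a ≤ ∑ b, A a b * v b) (m : ℕ)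
    {h : α → ℝ} (hh : ∀ a, 0 ≤ h a) :
    r ^ m * ∑ a, h a * v a ≤ ∑ s : Fin (m + 1) → α,
      h (s 0) * ((∏ i : Fin m, A (s i.castSucc) (s i.succ)) * v (s (Fin.last m))) := by
  induction m generalizing h with
  | zero =>
    rw [← (Equiv.funUnique (Fin 1) α).symm.sum_comp]
    simp
  | succ m ih =>
    rw [← (Fin.consEquiv fun _ : Fin (m + 2) => α).sum_comp, Fintype.sum_prod_type,
      Finset.mul_sum]
    refine Finset.sum_le_sum fun a _ => ?_
    have h1 := ih (h := A a) (hA a)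
    calc r ^ (m + 1) * (h a * v a) = h a * (r ^ m * (r * v a)) := by ring
      _ ≤ h a * (r ^ m * ∑ b, A a b * v b) := by
          have := hv a
          have := hh a
          gcongr
      _ ≤ h a * _ := mul_le_mul_of_nonneg_left h1 (hh a)
      _ = _ := by
          rw [Finset.mul_sum]
          refine Finset.sum_congr rfl fun s _ => ?_
          simp only [Fin.consEquiv_apply, Fin.prod_univ_succ (n := m), Fin.castSucc_zero,
            Fin.cons_zero, Fin.cons_succ, ← Fin.succ_last, ← Fin.succ_castSucc]
          ring

theorem prod_cyclic {α : Type*} (A : α → α → ℝ) {m : ℕ} (s : Fin (m + 1) → α) :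
    ∏ i, A (s i) (s (i + 1)) =
      (∏ i : Fin m, A (s i.castSucc) (s i.succ)) * A (s (Fin.last m)) (s 0) := by
  rw [Fin.prod_univ_castSucc]
  simp

theorem labelWeight_sq (lam mu rho : ℝ) {k : ℕ} (s : Fin (k + 3) → Bool) :
    labelWeight lam mu rho s ^ 2 =
      ∏ i, (coef lam mu (s i) ^ 2 * if s i = s (i + 1) then 1 else rho ^ 2) := by
  rw [labelWeight, ← Finset.prod_pow]
  refine Finset.prod_congr rfl fun i _ => ?_
  split_ifs <;> ring

theorem exists_growth {lam mu rho : ℝ} (hlam : 0 < lam) (hmu : 0 < mu) (hrho : 0 < rho)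
    (hmu1 : mu ≤ 1)
    (h : (1 - lam ^ 2) * (1 - mu ^ 2) < lam ^ 2 * rho ^ 2 * (mu ^ 2 * rho ^ 2)) :
    ∃ δ r : ℝ, 0 < δ ∧ 1 < r ∧
      ∀ k : ℕ, δ * r ^ k ≤ ∑ s : Fin (k + 3) → Bool, labelWeight lam mu rho s ^ 2 := by
  have hp : 0 < lam ^ 2 * rho ^ 2 := by positivity
  have hq : 0 < mu ^ 2 * rho ^ 2 := by positivity
  obtain ⟨t, ht0, ht1, ht2⟩ : ∃ t : ℝ, 0 < t ∧ 1 - lam ^ 2 < lam ^ 2 * rho ^ 2 * t ∧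
      t * (1 - mu ^ 2) < mu ^ 2 * rho ^ 2 := by
    rcases eq_or_lt_of_le hmu1 with rfl | hlt
    · refine ⟨1 / (lam ^ 2 * rho ^ 2), by positivity, ?_, ?_⟩
      · rw [mul_one_div_cancel hp.ne']
        nlinarith [sq_pos_of_pos hlam]
      · norm_num
        positivity
    · have hB : 0 < 1 - mu ^ 2 := by nlinarith
      obtain ⟨t, h1, h2⟩ := exists_between (show
        max 0 ((1 - lam ^ 2) / (lam ^ 2 * rho ^ 2)) < mu ^ 2 * rho ^ 2 / (1 - mu ^ 2) by
          rw [max_lt_iff]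
          refine ⟨by positivity, ?_⟩
          rw [div_lt_div_iff₀ hp hB]
          linarith)
      rw [max_lt_iff] at h1
      refine ⟨t, h1.1, ?_, ?_⟩
      · have := (div_lt_iff₀ hp).1 h1.2
        linarith
      · exact (lt_div_iff₀ hB).1 h2
  set A : Bool → Bool → ℝ := fun a b => coef lam mu a ^ 2 * if a = b then 1 else rho ^ 2 with hA
  have hApos : ∀ a b, 0 < A a b := by
    intro a b
    have : 0 < coef lam mu a := by cases a <;> simpa [coef]
    simp only [hA]
    split_ifs <;> positivity
  set v : Bool → ℝ := fun b => cond b 1 t with hv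
  have hvpos : ∀ b, 0 < v b := by
    intro b
    cases b <;> simp [hv, ht0]
  set r : ℝ := min (lam ^ 2 + lam ^ 2 * rho ^ 2 * t) (mu ^ 2 + mu ^ 2 * rho ^ 2 / t) with hr
  have hr1 : 1 < r := by
    rw [hr, lt_min_iff]
    refine ⟨by linarith, ?_⟩
    have : 1 - mu ^ 2 < mu ^ 2 * rho ^ 2 / t := by
      rw [lt_div_iff₀ ht0]
      linarith
    linarith
  have hsub : ∀ a, r * v a ≤ ∑ b, A a b * v b := by
    intro a
    cases a
    · have h1 : r * t ≤ (mu ^ 2 + mu ^ 2 * rho ^ 2 / t) * t := by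
        gcongr
        exact min_le_right _ _
      have h2 : (mu ^ 2 + mu ^ 2 * rho ^ 2 / t) * t = mu ^ 2 * t + mu ^ 2 * rho ^ 2 := by
        field_simp
      simp only [Fintype.sum_bool, hA, hv, coef, cond_true, cond_false, if_true,
        Bool.false_eq_true, if_false]
      linarith
    · have h1 : r ≤ lam ^ 2 + lam ^ 2 * rho ^ 2 * t := min_le_left _ _
      simp only [Fintype.sum_bool, hA, hv, coef, cond_true, cond_false, if_true,
        Bool.true_eq_false, if_false]
      linarith
  obtain ⟨η, hη, hηA⟩ : ∃ η : ℝ, 0 < η ∧ ∀ a b, η * v a ≤ A a b := by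
    refine ⟨Finset.univ.inf' Finset.univ_nonempty fun c : Bool × Bool => A c.1 c.2 / v c.1,
      ?_, fun a b => ?_⟩
    · rw [Finset.lt_inf'_iff]
      exact fun c _ => div_pos (hApos _ _) (hvpos _)
    · rw [← le_div_iff₀ (hvpos a)]
      exact Finset.inf'_le (fun c : Bool × Bool => A c.1 c.2 / v c.1) (Finset.mem_univ (a, b))
  refine ⟨η * ∑ a, v a, r, mul_pos hη (Finset.sum_pos (fun a _ => hvpos a) Finset.univ_nonempty),
    hr1, fun k => ?_⟩
  have h1 := pow_mul_sum_le_sum_path (fun a b => (hApos a b).le) (zero_le_one.trans hr1.le) hsub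
    (k + 2) (h := fun _ => η) fun _ => hη.le
  have h2 : r ^ k ≤ r ^ (k + 2) := pow_le_pow_right₀ hr1.le (by omega)
  have h3 : 0 ≤ ∑ a, η * v a := Finset.sum_nonneg fun a _ => (mul_pos hη (hvpos a)).le
  calc η * (∑ a, v a) * r ^ k = r ^ k * ∑ a, η * v a := by rw [Finset.mul_sum]; ring
    _ ≤ r ^ (k + 2) * ∑ a, η * v a := by gcongr
    _ ≤ _ := h1
    _ ≤ _ := by
        refine Finset.sum_le_sum fun s _ => ?_
        rw [labelWeight_sq]
        refine le_of_le_of_eq ?_ (prod_cyclic A (m := k + 2) s).symm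
        have h4 := hηA (s (Fin.last (k + 2))) (s 0)
        have h5 : 0 ≤ ∏ i : Fin (k + 2), A (s i.castSucc) (s i.succ) :=
          Finset.prod_nonneg fun i _ => (hApos _ _).le
        nlinarith

theorem pos_of_one_lt_thresholdF {lam mu rho : ℝ} (hlam : 0 ≤ lam ∧ lam ≤ 1)
    (hmu : 0 ≤ mu ∧ mu ≤ 1) (hrho : 0 ≤ rho) (hF : 1 < thresholdF lam mu rho 1) :
    0 < lam ∧ 0 < mu ∧ 0 < rho ∧
      (1 - lam ^ 2) * (1 - mu ^ 2) < lam ^ 2 * rho ^ 2 * (mu ^ 2 * rho ^ 2) := by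
  have hA : 0 ≤ 1 - lam ^ 2 := by nlinarith [hlam.1, hlam.2]
  have hB : 0 ≤ 1 - mu ^ 2 := by nlinarith [hmu.1, hmu.2]
  have hp0 : 0 ≤ lam ^ 2 * rho ^ 2 := by positivity
  have hq0 : 0 ≤ mu ^ 2 * rho ^ 2 := by positivity
  have h1 : 1 < lam ^ 2 * rho ^ 2 / (1 - lam ^ 2 + lam ^ 2 * rho ^ 2) +
      mu ^ 2 * rho ^ 2 / (1 - mu ^ 2 + mu ^ 2 * rho ^ 2) := by
    unfold thresholdF at hF
    rw [lt_max_iff, lt_max_iff, div_one, div_one] at hF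
    rcases hF with h | h | h
    · linarith
    · linarith
    · exact h
  have ha : lam ^ 2 * rho ^ 2 / (1 - lam ^ 2 + lam ^ 2 * rho ^ 2) ≤ 1 :=
    div_le_one_of_le₀ (by linarith) (by linarith)
  have hb : mu ^ 2 * rho ^ 2 / (1 - mu ^ 2 + mu ^ 2 * rho ^ 2) ≤ 1 :=
    div_le_one_of_le₀ (by linarith) (by linarith)
  have hp : 0 < lam ^ 2 * rho ^ 2 := by
    refine lt_of_le_of_ne hp0 fun h => ?_
    rw [← h, zero_div] at h1
    linarith
  have hq : 0 < mu ^ 2 * rho ^ 2 := by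
    refine lt_of_le_of_ne hq0 fun h => ?_
    rw [← h, zero_div] at h1
    linarith
  refine ⟨lt_of_le_of_ne hlam.1 ?_, lt_of_le_of_ne hmu.1 ?_, lt_of_le_of_ne hrho ?_, ?_⟩
  · rintro rfl
    simp at hp
  · rintro rfl
    simp at hq
  · rintro rfl
    simp at hq
  · rw [div_add_div _ _ (by linarith) (by linarith), lt_div_iff₀ (by nlinarith)] at h1
    nlinarith

/-! ### Decorated cycles and their labelings -/

namespace DecoratedGraph

variable {U V W : Type}

theorem Isomorphic.symm {H : DecoratedGraph V} {K : DecoratedGraph W} (h : H.Isomorphic K) :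
    K.Isomorphic H := by
  obtain ⟨σ, h⟩ := h
  refine ⟨σ.symm, fun u v => ?_⟩
  have := h (σ.symm u) (σ.symm v)
  simp only [Equiv.apply_symm_apply] at this
  exact ⟨this.1.symm, this.2.symm⟩

theorem Isomorphic.trans {H : DecoratedGraph U} {K : DecoratedGraph V} {L : DecoratedGraph W}
    (h : H.Isomorphic K) (h' : K.Isomorphic L) : H.Isomorphic L := by
  obtain ⟨σ, h⟩ := h
  obtain ⟨τ, h'⟩ := h'
  exact ⟨σ.trans τ, fun u v => ⟨(h u v).1.trans (h' _ _).1, (h u v).2.trans (h' _ _).2⟩⟩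

end DecoratedGraph

namespace LabeledCycle

variable {k : ℕ} {V W : Type}

theorem mk_apply_eq_iff (p : LabeledCycle k V) (i a b : Fin (k + 3)) :
    s(p.1 i, p.1 (i + 1)) = s(p.1 a, p.1 b) ↔ s(i, i + 1) = s(a, b) := by
  simp only [Sym2.eq_iff, EmbeddingLike.apply_eq_iff_eq]

variable [DecidableEq V] [DecidableEq W]

/-- The decorated graph of a labeled cycle. -/
def graph (p : LabeledCycle k V) : DecoratedGraph V where
  verts := Finset.univ.map p.1
  bullet := (Finset.univ.filter fun i => p.2 i = true).image fun i => s(p.1 i, p.1 (i + 1))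
  circ := (Finset.univ.filter fun i => p.2 i = false).image fun i => s(p.1 i, p.1 (i + 1))
  disjoint_edges := by
    rw [Finset.disjoint_left]
    intro e he he'
    simp only [Finset.mem_image, Finset.mem_filter, Finset.mem_univ, true_and] at he he'
    obtain ⟨i, hi, rfl⟩ := he
    obtain ⟨j, hj, h⟩ := he'
    rw [mk_succ_injective p.1 h, hi] at hj
    exact absurd hj (by simp)
  loopless := by
    intro e he
    simp only [Finset.mem_image, Finset.mem_filter, Finset.mem_univ, true_and] at he
    rcases he with ⟨i, -, rfl⟩ | ⟨i, -, rfl⟩ <;> exact p.not_isDiag_edge i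
  incident := by
    intro e he v hv
    simp only [Finset.mem_image, Finset.mem_filter, Finset.mem_univ, true_and] at he
    rcases he with ⟨i, -, rfl⟩ | ⟨i, -, rfl⟩ <;>
    · rw [Sym2.mem_iff] at hv
      rcases hv with rfl | rfl <;> simp

theorem mem_verts_graph {p : LabeledCycle k V} {v : V} : v ∈ p.graph.verts ↔ ∃ i, p.1 i = v := by
  simp [graph]

theorem mem_bullet_graph {p : LabeledCycle k V} {e : Sym2 V} :
    e ∈ p.graph.bullet ↔ ∃ i, p.2 i = true ∧ s(p.1 i, p.1 (i + 1)) = e := by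
  simp [graph]

theorem mem_circ_graph {p : LabeledCycle k V} {e : Sym2 V} :
    e ∈ p.graph.circ ↔ ∃ i, p.2 i = false ∧ s(p.1 i, p.1 (i + 1)) = e := by
  simp [graph]

theorem mem_edges_iff {p : LabeledCycle k V} {d : Sym2 V × Bool} :
    d ∈ p.edges ↔ d.1 ∈ cond d.2 p.graph.bullet p.graph.circ := by
  obtain ⟨e, b⟩ := d
  rw [mem_edges]
  cases b
  · simp only [cond_false, mem_circ_graph, edge, Prod.mk.injEq, and_comm]
  · simp only [cond_true, mem_bullet_graph, edge, Prod.mk.injEq, and_comm]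

theorem graph_eq_iff {p q : LabeledCycle k V} : p.graph = q.graph ↔ p.edges = q.edges := by
  constructor
  · intro h
    ext d
    rw [mem_edges_iff, mem_edges_iff, h]
  · intro h
    refine DecoratedGraph.ext ?_ ?_ ?_
    · ext v
      simp only [mem_verts_graph]
      constructor
      · rintro ⟨i, rfl⟩
        exact apply_mem_range_of_edges_eq h.symm i
      · rintro ⟨i, rfl⟩
        exact apply_mem_range_of_edges_eq h i
    · ext e
      have h1 := Finset.ext_iff.1 h (e, true)
      simpa only [mem_edges_iff, cond_true] using h1
    · ext e
      have h1 := Finset.ext_iff.1 h (e, false)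
      simpa only [mem_edges_iff, cond_false] using h1

/-- The vertices of the graph of a labeled cycle. -/
noncomputable def vertsEquiv (p : LabeledCycle k V) : Fin (k + 3) ≃ p.graph.verts :=
  Equiv.ofBijective (fun i => ⟨p.1 i, mem_verts_graph.2 ⟨i, rfl⟩⟩)
    ⟨fun i j h => p.1.injective (congrArg Subtype.val h), fun v => by
      obtain ⟨i, hi⟩ := mem_verts_graph.1 v.2
      exact ⟨i, Subtype.ext hi⟩⟩

theorem coe_vertsEquiv (p : LabeledCycle k V) (i : Fin (k + 3)) : (p.vertsEquiv i).1 = p.1 i := rfl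

theorem isomorphic_graph {p : LabeledCycle k V} {q : LabeledCycle k W} (h : p.2 = q.2) :
    p.graph.Isomorphic q.graph := by
  refine ⟨p.vertsEquiv.symm.trans q.vertsEquiv, fun u v => ?_⟩
  obtain ⟨a, rfl⟩ := p.vertsEquiv.surjective u
  obtain ⟨b, rfl⟩ := p.vertsEquiv.surjective v
  simp only [Equiv.trans_apply, Equiv.symm_apply_apply, coe_vertsEquiv, mem_bullet_graph,
    mem_circ_graph, mk_apply_eq_iff, h, and_self]

theorem exists_graph_eq_of_isomorphic {p : LabeledCycle k V} {K : DecoratedGraph W}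
    (h : p.graph.Isomorphic K) : ∃ q : LabeledCycle k W, q.graph = K ∧ q.2 = p.2 := by
  obtain ⟨σ, hσ⟩ := h
  let q : LabeledCycle k W := (⟨fun i => (σ (p.vertsEquiv i)).1, fun i j hij =>
    p.vertsEquiv.injective (σ.injective (Subtype.ext hij))⟩, p.2)
  have hq : ∀ i, (σ (p.vertsEquiv i)).1 = q.1 i := fun i => rfl
  have hverts : ∀ v : K.verts, ∃ i, q.1 i = v.1 := fun v =>
    ⟨p.vertsEquiv.symm (σ.symm v), by simp [← hq]⟩
  have hb : ∀ a b : Fin (k + 3), (s(q.1 a, q.1 b) ∈ q.graph.bullet ↔ s(q.1 a, q.1 b) ∈ K.bullet) ∧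
      (s(q.1 a, q.1 b) ∈ q.graph.circ ↔ s(q.1 a, q.1 b) ∈ K.circ) := by
    intro a b
    have h1 := hσ (p.vertsEquiv a) (p.vertsEquiv b)
    have hq2 : q.2 = p.2 := rfl
    rw [hq, hq] at h1
    rw [← h1.1, ← h1.2]
    simp only [coe_vertsEquiv, mem_bullet_graph, mem_circ_graph, mk_apply_eq_iff, hq2, and_self]
  have hmem : ∀ e : Sym2 W, (e ∈ q.graph.bullet ∨ e ∈ q.graph.circ) ∨ (e ∈ K.bullet ∨ e ∈ K.circ) →
      ∃ a b, e = s(q.1 a, q.1 b) := by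
    intro e he
    induction e with
    | _ u v =>
      rcases he with he | he
      · obtain ⟨a, ha⟩ := mem_verts_graph.1 (q.graph.incident _ he u (Sym2.mem_mk_left _ _))
        obtain ⟨b, hb⟩ := mem_verts_graph.1 (q.graph.incident _ he v (Sym2.mem_mk_right _ _))
        exact ⟨a, b, by rw [ha, hb]⟩
      · obtain ⟨a, ha⟩ := hverts ⟨u, K.incident _ he u (Sym2.mem_mk_left _ _)⟩
        obtain ⟨b, hb⟩ := hverts ⟨v, K.incident _ he v (Sym2.mem_mk_right _ _)⟩
        exact ⟨a, b, by rw [ha, hb]⟩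
  refine ⟨q, DecoratedGraph.ext ?_ ?_ ?_, rfl⟩
  · ext v
    rw [mem_verts_graph]
    constructor
    · rintro ⟨i, rfl⟩
      exact (σ (p.vertsEquiv i)).2
    · intro hv
      exact hverts ⟨v, hv⟩
  · ext e
    constructor
    · intro he
      obtain ⟨a, b, rfl⟩ := hmem e (Or.inl (Or.inl he))
      exact (hb a b).1.1 he
    · intro he
      obtain ⟨a, b, rfl⟩ := hmem e (Or.inr (Or.inl he))
      exact (hb a b).1.2 he
  · ext e
    constructor
    · intro he
      obtain ⟨a, b, rfl⟩ := hmem e (Or.inl (Or.inr he))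
      exact (hb a b).2.1 he
    · intro he
      obtain ⟨a, b, rfl⟩ := hmem e (Or.inr (Or.inr he))
      exact (hb a b).2.2 he

theorem isCycle_graph (p : LabeledCycle k V) : p.graph.IsCycle (k + 3) := by
  refine ⟨by omega, ⟨⟨p.vertsEquiv, fun {a b} => ?_⟩⟩⟩
  rw [SimpleGraph.cycleGraph_adj]
  change (s(p.1 a, p.1 b) ∈ p.graph.bullet ∨ s(p.1 a, p.1 b) ∈ p.graph.circ) ↔ _
  simp only [mem_bullet_graph, mem_circ_graph, Sym2.eq_iff, EmbeddingLike.apply_eq_iff_eq]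
  constructor
  · rintro (⟨i, -, ⟨rfl, rfl⟩ | ⟨rfl, rfl⟩⟩ | ⟨i, -, ⟨rfl, rfl⟩ | ⟨rfl, rfl⟩⟩) <;> simp
  · rintro (h | h)
    · have h1 : b + 1 = a := by rw [← h]; abel
      cases hb : p.2 b
      · exact Or.inr ⟨b, hb, Or.inr ⟨rfl, h1⟩⟩
      · exact Or.inl ⟨b, hb, Or.inr ⟨rfl, h1⟩⟩
    · have h1 : a + 1 = b := by rw [← h]; abel
      cases ha : p.2 a
      · exact Or.inr ⟨a, ha, Or.inl ⟨rfl, h1⟩⟩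
      · exact Or.inl ⟨a, ha, Or.inl ⟨rfl, h1⟩⟩

theorem exists_graph_eq_of_isCycle {S : DecoratedGraph V} (h : S.IsCycle (k + 3)) :
    ∃ p : LabeledCycle k V, p.graph = S := by
  obtain ⟨-, ⟨α⟩⟩ := h
  let φ : Fin (k + 3) ↪ V := ⟨fun i => (α i).1, fun i j hij => α.injective (Subtype.ext hij)⟩
  let p : LabeledCycle k V := (φ, fun i => decide (s(φ i, φ (i + 1)) ∈ S.bullet))
  have hadj : ∀ i, s(φ i, φ (i + 1)) ∈ S.bullet ∨ s(φ i, φ (i + 1)) ∈ S.circ := by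
    intro i
    have h1 : (SimpleGraph.cycleGraph (k + 3)).Adj i (i + 1) := by
      rw [SimpleGraph.cycleGraph_adj]
      right
      abel
    exact α.map_rel_iff.2 h1
  have hedge : ∀ e, e ∈ S.bullet ∨ e ∈ S.circ → ∃ i, s(φ i, φ (i + 1)) = e := by
    intro e he
    induction e with
    | _ u v =>
      have hu := S.incident _ he u (Sym2.mem_mk_left _ _)
      have hv := S.incident _ he v (Sym2.mem_mk_right _ _)
      have h1 : S.toGraph.Adj ⟨u, hu⟩ ⟨v, hv⟩ := he
      obtain ⟨a, ha⟩ := α.surjective ⟨u, hu⟩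
      obtain ⟨b, hb⟩ := α.surjective ⟨v, hv⟩
      rw [← ha, ← hb, α.map_rel_iff, SimpleGraph.cycleGraph_adj] at h1
      have hu' : φ a = u := congrArg Subtype.val ha
      have hv' : φ b = v := congrArg Subtype.val hb
      rcases h1 with h1 | h1
      · have h2 : b + 1 = a := by rw [← h1]; abel
        exact ⟨b, by rw [h2, hu', hv', Sym2.eq_swap]⟩
      · have h2 : a + 1 = b := by rw [← h1]; abel
        exact ⟨a, by rw [h2, hu', hv']⟩
  refine ⟨p, DecoratedGraph.ext ?_ ?_ ?_⟩
  · ext v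
    rw [mem_verts_graph]
    constructor
    · rintro ⟨i, rfl⟩
      exact (α i).2
    · intro hv
      obtain ⟨a, ha⟩ := α.surjective ⟨v, hv⟩
      exact ⟨a, congrArg Subtype.val ha⟩
  · ext e
    rw [mem_bullet_graph]
    simp only [p, decide_eq_true_eq]
    constructor
    · rintro ⟨i, hi, rfl⟩
      exact hi
    · intro he
      obtain ⟨i, rfl⟩ := hedge e (Or.inl he)
      exact ⟨i, he, rfl⟩
  · ext e
    rw [mem_circ_graph]
    simp only [p, decide_eq_false_iff_not]
    constructor
    · rintro ⟨i, hi, rfl⟩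
      exact (hadj i).resolve_left hi
    · intro he
      obtain ⟨i, rfl⟩ := hedge e (Or.inr he)
      exact ⟨i, fun h => Finset.disjoint_left.1 S.disjoint_edges h he, rfl⟩

theorem mem_bulletVerts_graph {p : LabeledCycle k V} {v : V} :
    v ∈ p.graph.bulletVerts ↔ ∃ i, p.2 i = true ∧ (p.1 i = v ∨ p.1 (i + 1) = v) := by
  simp only [DecoratedGraph.bulletVerts, Finset.mem_filter, mem_verts_graph, mem_bullet_graph,
    Sym2.eq_iff]
  constructor
  · rintro ⟨-, u, -, i, hi, h | h⟩
    · exact ⟨i, hi, Or.inl h.1⟩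
    · exact ⟨i, hi, Or.inr h.2⟩
  · rintro ⟨i, hi, rfl | rfl⟩
    · exact ⟨⟨i, rfl⟩, _, ⟨i + 1, rfl⟩, i, hi, Or.inl ⟨rfl, rfl⟩⟩
    · exact ⟨⟨i + 1, rfl⟩, _, ⟨i, rfl⟩, i, hi, Or.inr ⟨rfl, rfl⟩⟩

theorem mem_circVerts_graph {p : LabeledCycle k V} {v : V} :
    v ∈ p.graph.circVerts ↔ ∃ i, p.2 i = false ∧ (p.1 i = v ∨ p.1 (i + 1) = v) := by
  simp only [DecoratedGraph.circVerts, Finset.mem_filter, mem_verts_graph, mem_circ_graph,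
    Sym2.eq_iff]
  constructor
  · rintro ⟨-, u, -, i, hi, h | h⟩
    · exact ⟨i, hi, Or.inl h.1⟩
    · exact ⟨i, hi, Or.inr h.2⟩
  · rintro ⟨i, hi, rfl | rfl⟩
    · exact ⟨⟨i, rfl⟩, _, ⟨i + 1, rfl⟩, i, hi, Or.inl ⟨rfl, rfl⟩⟩
    · exact ⟨⟨i + 1, rfl⟩, _, ⟨i, rfl⟩, i, hi, Or.inr ⟨rfl, rfl⟩⟩

theorem card_diff_graph (p : LabeledCycle k V) :
    p.graph.diff.card = (Finset.univ.filter fun i => p.2 i ≠ p.2 (i + 1)).card := by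
  rw [← Finset.card_image_of_injective (Finset.univ.filter fun i => p.2 i ≠ p.2 (i + 1))
    (p.1.injective.comp (add_left_injective (1 : Fin (k + 3))))]
  congr 1
  ext v
  simp only [DecoratedGraph.diff, Finset.mem_inter, mem_bulletVerts_graph, mem_circVerts_graph,
    Finset.mem_image, Finset.mem_filter, Finset.mem_univ, true_and, Function.comp_apply]
  constructor
  · rintro ⟨⟨i, hi, h⟩, j, hj, h'⟩
    rcases h with rfl | rfl <;> rcases h' with h' | h' <;> have h1 := p.1.injective h'
    · rw [h1, hi] at hj
      exact absurd hj (by simp)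
    · exact ⟨j, by rw [h1, hi, hj]; simp, h'⟩
    · exact ⟨i, by rw [← h1, hi, hj]; simp, rfl⟩
    · rw [add_right_cancel h1, hi] at hj
      exact absurd hj (by simp)
  · rintro ⟨i, hi, rfl⟩
    cases h : p.2 i
    · have h1 : p.2 (i + 1) = true := by
        rw [h] at hi
        simpa using hi.symm
      exact ⟨⟨i + 1, h1, Or.inl rfl⟩, i, h, Or.inr rfl⟩
    · have h1 : p.2 (i + 1) = false := by
        rw [h] at hi
        simpa using hi.symm
      exact ⟨⟨i, h, Or.inr rfl⟩, i + 1, h1, Or.inl rfl⟩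

theorem weight_graph (lam mu rho : ℝ) (p : LabeledCycle k V) :
    p.graph.weight lam mu rho = labelWeight lam mu rho p.2 := by
  have h1 : p.graph.bullet.card = (Finset.univ.filter fun i => p.2 i = true).card :=
    Finset.card_image_of_injective _ (mk_succ_injective p.1)
  have h2 : p.graph.circ.card = (Finset.univ.filter fun i => ¬ p.2 i = true).card := by
    simp only [Bool.not_eq_true]
    exact Finset.card_image_of_injective _ (mk_succ_injective p.1)
  have h3 : ∏ i, coef lam mu (p.2 i) = ∏ i, if p.2 i = true then lam else mu :=
    Finset.prod_congr rfl fun i _ => by cases p.2 i <;> simp [coef]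
  rw [DecoratedGraph.weight, labelWeight, Finset.prod_mul_distrib, h1, h2, card_diff_graph, h3,
    Finset.prod_ite, Finset.prod_ite]
  simp

theorem labelWeight_eq_of_edges_eq (lam mu rho : ℝ) {p q : LabeledCycle k V}
    (h : p.edges = q.edges) : labelWeight lam mu rho p.2 = labelWeight lam mu rho q.2 := by
  rw [← weight_graph, ← weight_graph, graph_eq_iff.2 h]

theorem edgeProduct_graph {n : ℕ} (p : LabeledCycle k (Fin n)) (M : MatrixPair n) :
    edgeProduct p.graph M = cycleProd p M := by
  have h1 : ∏ e ∈ p.graph.bullet, M.1 e.inf e.sup =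
      ∏ i ∈ Finset.univ.filter fun i => p.2 i = true, entry M (p.edge i) := by
    refine (Finset.prod_image fun i _ j _ h => mk_succ_injective p.1 h).trans
      (Finset.prod_congr rfl fun i hi => ?_)
    simp [entry, edge, (Finset.mem_filter.1 hi).2]
  have h2 : ∏ e ∈ p.graph.circ, M.2 e.inf e.sup =
      ∏ i ∈ Finset.univ.filter fun i => ¬ p.2 i = true, entry M (p.edge i) := by
    simp only [Bool.not_eq_true]
    refine (Finset.prod_image fun i _ j _ h => mk_succ_injective p.1 h).trans
      (Finset.prod_congr rfl fun i hi => ?_)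
    simp [entry, edge, (Finset.mem_filter.1 hi).2]
  rw [edgeProduct, h1, h2, Finset.prod_filter_mul_prod_filter_not, cycleProd]

end LabeledCycle

/-! ### The statistic as a sum over labeled cycles -/

open Classical in
theorem mem_cycleClasses {k : ℕ} {h : UnlabeledGraph (k + 3)} :
    h ∈ cycleClasses (k + 3) ↔ ∃ p : LabeledCycle k (Fin (k + 3)), h.out = p.graph := by
  simp only [cycleClasses, Finset.mem_filter, Finset.mem_univ, true_and]
  constructor
  · rintro ⟨H, hH, rfl⟩
    obtain ⟨p, rfl⟩ := LabeledCycle.exists_graph_eq_of_isCycle hH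
    have h1 : DecoratedGraph.Isomorphic
        (Quotient.mk (DecoratedGraph.isoSetoid (Fin (k + 3))) p.graph).out p.graph :=
      Quotient.mk_out (s := DecoratedGraph.isoSetoid (Fin (k + 3))) p.graph
    obtain ⟨q, hq, -⟩ := LabeledCycle.exists_graph_eq_of_isomorphic h1.symm
    exact ⟨q, hq.symm⟩
  · rintro ⟨p, hp⟩
    exact ⟨p.graph, p.isCycle_graph, by rw [← hp, Quotient.out_eq]⟩

theorem cycleClasses_eq_empty {l : ℕ} (h : l < 3) : cycleClasses l = ∅ := by
  classical
  rw [Finset.eq_empty_iff_forall_notMem]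
  intro c hc
  simp only [cycleClasses, Finset.mem_filter] at hc
  obtain ⟨-, H, hH, -⟩ := hc
  exact absurd hH.1 (by omega)

open Classical in
theorem sum_cycleClasses {k n : ℕ} (lam mu rho : ℝ) (M : MatrixPair n) :
    ∑ h ∈ cycleClasses (k + 3), h.out.weight lam mu rho *
        ∑ S : DecoratedGraph (Fin n) with h.out.Isomorphic S, edgeProduct S M =
      ∑ S ∈ Finset.univ.image (LabeledCycle.graph : LabeledCycle k (Fin n) → _),
        S.weight lam mu rho * edgeProduct S M := by
  have h1 : ∀ h ∈ cycleClasses (k + 3), h.out.weight lam mu rho *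
      ∑ S : DecoratedGraph (Fin n) with h.out.Isomorphic S, edgeProduct S M =
      ∑ S : DecoratedGraph (Fin n) with h.out.Isomorphic S,
        S.weight lam mu rho * edgeProduct S M := by
    intro h hh
    obtain ⟨p, hp⟩ := mem_cycleClasses.1 hh
    rw [Finset.mul_sum]
    refine Finset.sum_congr rfl fun S hS => ?_
    have hS1 := (Finset.mem_filter.1 hS).2
    rw [hp] at hS1 ⊢
    obtain ⟨q, rfl, hq⟩ := LabeledCycle.exists_graph_eq_of_isomorphic hS1
    rw [LabeledCycle.weight_graph, LabeledCycle.weight_graph, hq]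
  rw [Finset.sum_congr rfl h1, ← Finset.sum_biUnion]
  · refine Finset.sum_congr ?_ fun _ _ => rfl
    ext S
    simp only [Finset.mem_biUnion, Finset.mem_filter, Finset.mem_univ, true_and, Finset.mem_image]
    constructor
    · rintro ⟨h, hh, hS⟩
      obtain ⟨p, hp⟩ := mem_cycleClasses.1 hh
      rw [hp] at hS
      obtain ⟨q, hq, -⟩ := LabeledCycle.exists_graph_eq_of_isomorphic hS
      exact ⟨q, hq⟩
    · rintro ⟨q, rfl⟩
      let p : LabeledCycle k (Fin (k + 3)) := (Function.Embedding.refl _, q.2)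
      have h2 : DecoratedGraph.Isomorphic
          (Quotient.mk (DecoratedGraph.isoSetoid (Fin (k + 3))) p.graph).out p.graph :=
        Quotient.mk_out (s := DecoratedGraph.isoSetoid (Fin (k + 3))) p.graph
      refine ⟨Quotient.mk (DecoratedGraph.isoSetoid (Fin (k + 3))) p.graph, ?_,
        h2.trans (LabeledCycle.isomorphic_graph rfl)⟩
      obtain ⟨r, hr, -⟩ := LabeledCycle.exists_graph_eq_of_isomorphic h2.symm
      exact mem_cycleClasses.2 ⟨r, hr.symm⟩
  · intro h _ h' _ hne
    rw [Function.onFun, Finset.disjoint_left]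
    intro S hS hS'
    have hS1 := (Finset.mem_filter.1 hS).2
    have hS2 := (Finset.mem_filter.1 hS').2
    apply hne
    rw [← Quotient.out_eq h, ← Quotient.out_eq h']
    exact Quotient.sound (s := DecoratedGraph.isoSetoid (Fin (k + 3))) (hS1.trans hS2.symm)

/-- The statistic is a sum over labeled cycles, one for each decorated cycle. -/
theorem exists_representatives (k n : ℕ) : ∃ R : Finset (LabeledCycle k (Fin n)),
    (∀ p ∈ R, ∀ q ∈ R, p.edges = q.edges → p = q) ∧
    (∀ p : LabeledCycle k (Fin n), ∃ q ∈ R, q.edges = p.edges) ∧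
    ∀ (lam mu rho : ℝ) (M : MatrixPair n), cycleStat lam mu rho (k + 3) n M =
      1 / √((n : ℝ) ^ (k + 3) * cycleBeta lam mu rho (k + 3)) *
        ∑ p ∈ R, labelWeight lam mu rho p.2 * cycleProd p M := by
  classical
  obtain ⟨R, -, hinj, himg⟩ := Finset.exists_subset_injOn_image_eq_of_surjOn
    (f := (LabeledCycle.graph : LabeledCycle k (Fin n) → _)) (s := Set.univ)
    (Finset.univ.image (LabeledCycle.graph : LabeledCycle k (Fin n) → _)) (by
      intro S hS
      simpa using hS)
  refine ⟨R, fun p hp q hq h => hinj hp hq (LabeledCycle.graph_eq_iff.2 h), fun p => ?_,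
    fun lam mu rho M => ?_⟩
  · have h1 : p.graph ∈ R.image LabeledCycle.graph := by
      rw [himg]
      exact Finset.mem_image_of_mem _ (Finset.mem_univ p)
    obtain ⟨q, hq, h2⟩ := Finset.mem_image.1 h1
    exact ⟨q, hq, LabeledCycle.graph_eq_iff.1 h2⟩
  · rw [cycleStat, sum_cycleClasses, ← himg, Finset.sum_image hinj]
    simp only [LabeledCycle.weight_graph, LabeledCycle.edgeProduct_graph]

theorem cycleBeta_pos {lam mu rho : ℝ} (hlam : 0 < lam) (hmu : 0 < mu) (hrho : 0 < rho) (k : ℕ) :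
    0 < cycleBeta lam mu rho (k + 3) := by
  classical
  unfold cycleBeta
  refine Finset.sum_pos (fun h _ => ?_) ?_
  · have h1 : 0 < h.out.autCount := by
      unfold DecoratedGraph.autCount
      have : Nonempty {σ : h.out.verts ≃ h.out.verts // DecoratedGraph.IsIso h.out h.out σ} :=
        ⟨⟨Equiv.refl _, fun _ _ => ⟨Iff.rfl, Iff.rfl⟩⟩⟩
      exact Nat.card_pos
    have h2 : 0 < h.out.weight lam mu rho := by
      unfold DecoratedGraph.weight
      positivity
    positivity
  · let p : LabeledCycle k (Fin (k + 3)) := (Function.Embedding.refl _, fun _ => true)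
    refine ⟨Quotient.mk (DecoratedGraph.isoSetoid (Fin (k + 3))) p.graph, ?_⟩
    simp only [cycleClasses, Finset.mem_filter, Finset.mem_univ, true_and]
    exact ⟨p.graph, p.isCycle_graph, rfl⟩

/-! ### First and second moments of the weighted cycle count -/

/-- The weighted sum of the products along the labeled cycles in `R`. -/
def cycleSum (lam mu rho : ℝ) {k n : ℕ} (R : Finset (LabeledCycle k (Fin n)))
    (M : MatrixPair n) : ℝ :=
  ∑ p ∈ R, labelWeight lam mu rho p.2 * cycleProd p M

theorem labelWeight_nonneg {lam mu rho : ℝ} (hlam : 0 ≤ lam) (hmu : 0 ≤ mu) (hrho : 0 ≤ rho)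
    {k : ℕ} (s : Fin (k + 3) → Bool) : 0 ≤ labelWeight lam mu rho s := by
  refine Finset.prod_nonneg fun i _ => mul_nonneg ?_ ?_
  · cases s i <;> simpa [coef]
  · split_ifs
    · exact zero_le_one
    · exact hrho

theorem labelWeight_le_one {lam mu rho : ℝ} (hlam : 0 ≤ lam ∧ lam ≤ 1) (hmu : 0 ≤ mu ∧ mu ≤ 1)
    (hrho : 0 ≤ rho ∧ rho ≤ 1) {k : ℕ} (s : Fin (k + 3) → Bool) :
    labelWeight lam mu rho s ≤ 1 := by
  have h1 : ∀ b, 0 ≤ coef lam mu b ∧ coef lam mu b ≤ 1 := by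
    intro b
    cases b
    · exact hmu
    · exact hlam
  refine Finset.prod_le_one (fun i _ => mul_nonneg (h1 _).1 ?_) fun i _ =>
    mul_le_one₀ (h1 _).2 ?_ ?_ <;> split_ifs
  · exact zero_le_one
  · exact hrho.1
  · exact zero_le_one
  · exact hrho.1
  · exact le_rfl
  · exact hrho.2

section

variable {k n : ℕ} {p : Measure (ℝ × ℝ)} {rho C lam mu : ℝ}

theorem memLp_cycleSum (hp : IsCorrelatedPrior p rho C) (hlam : |lam| ≤ 1) (hmu : |mu| ≤ 1)
    (lam' mu' rho' : ℝ) (R : Finset (LabeledCycle k (Fin n))) :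
    MemLp (cycleSum lam' mu' rho' R) 2 (spikedLaw lam mu p n) :=
  memLp_finsetSum R fun q _ => (memLp_cycleProd hp hlam hmu q).const_mul _

theorem isProbabilityMeasure_spikedLaw (lam mu : ℝ) (hp : IsCorrelatedPrior p rho C) (n : ℕ) :
    IsProbabilityMeasure (spikedLaw lam mu p n) := by
  have := hp.prob
  rw [spikedLaw_eq_map]
  exact Measure.isProbabilityMeasure_map (measurable_sampleMap lam mu n).aemeasurable

theorem integral_cycleSum_eq (hp : IsCorrelatedPrior p rho C) (hlam : |lam| ≤ 1) (hmu : |mu| ≤ 1)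
    (lam' mu' rho' : ℝ) (R : Finset (LabeledCycle k (Fin n))) :
    ∫ M, cycleSum lam' mu' rho' R M ∂(spikedLaw lam mu p n) =
      ∑ q ∈ R, labelWeight lam' mu' rho' q.2 * ∫ M, cycleProd q M ∂(spikedLaw lam mu p n) := by
  have := isProbabilityMeasure_spikedLaw lam mu hp n
  unfold cycleSum
  rw [integral_finsetSum]
  · simp only [integral_const_mul]
  · exact fun q _ => ((memLp_cycleProd hp hlam hmu q).integrable (by norm_num)).const_mul _

theorem integral_cycleSum_sq_eq (hp : IsCorrelatedPrior p rho C) (hlam : |lam| ≤ 1)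
    (hmu : |mu| ≤ 1) (lam' mu' rho' : ℝ) (R : Finset (LabeledCycle k (Fin n))) :
    ∫ M, cycleSum lam' mu' rho' R M ^ 2 ∂(spikedLaw lam mu p n) =
      ∑ q ∈ R, ∑ q' ∈ R, labelWeight lam' mu' rho' q.2 * labelWeight lam' mu' rho' q'.2 *
        ∫ M, cycleProd q M * cycleProd q' M ∂(spikedLaw lam mu p n) := by
  have h1 : ∀ q q' : LabeledCycle k (Fin n), Integrable (fun M =>
      labelWeight lam' mu' rho' q.2 * labelWeight lam' mu' rho' q'.2 *
        (cycleProd q M * cycleProd q' M)) (spikedLaw lam mu p n) := fun q q' =>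
    ((memLp_cycleProd hp hlam hmu q).integrable_mul (memLp_cycleProd hp hlam hmu q')).const_mul _
  have h2 : ∀ M, cycleSum lam' mu' rho' R M ^ 2 = ∑ q ∈ R, ∑ q' ∈ R,
      labelWeight lam' mu' rho' q.2 * labelWeight lam' mu' rho' q'.2 *
        (cycleProd q M * cycleProd q' M) := by
    intro M
    rw [sq, cycleSum, Finset.sum_mul_sum]
    exact Finset.sum_congr rfl fun q _ => Finset.sum_congr rfl fun q' _ => by ring
  simp only [h2]
  rw [integral_finsetSum _ fun q _ => integrable_finsetSum _ fun q' _ => h1 q q']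
  refine Finset.sum_congr rfl fun q _ => ?_
  rw [integral_finsetSum _ fun q' _ => h1 q q']
  simp only [integral_const_mul]

/-- The mean of the weighted count under the spiked law. -/
theorem integral_cycleSum (hp : IsCorrelatedPrior p rho C) (hlam : |lam| ≤ 1) (hmu : |mu| ≤ 1)
    (R : Finset (LabeledCycle k (Fin n))) :
    ∫ M, cycleSum lam mu rho R M ∂(spikedLaw lam mu p n) =
      (1 / √(n : ℝ)) ^ (k + 3) * ∑ q ∈ R, labelWeight lam mu rho q.2 ^ 2 := by
  rw [integral_cycleSum_eq hp hlam hmu, Finset.mul_sum]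
  refine Finset.sum_congr rfl fun q _ => ?_
  rw [integral_cycleProd hp hlam hmu]
  ring

theorem signal_zero (x : Fin n → ℝ × ℝ) (d : Sym2 (Fin n) × Bool) : signal 0 0 x d = 0 := by
  obtain ⟨e, b⟩ := d
  cases b <;> simp [signal, coef]

theorem integral_cycleProd_mul_null (hp : IsCorrelatedPrior p rho C)
    (q q' : LabeledCycle k (Fin n)) :
    ∫ M, cycleProd q M * cycleProd q' M ∂(spikedLaw 0 0 p n) =
      if q.edges = q'.edges then 1 else 0 := by
  have := hp.prob
  rw [integral_cycleProd_mul_eq hp (by simp) (by simp)]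
  split_ifs with h
  · simp [condSecond, signal_zero, h]
  · have h1 : (q.edges \ q'.edges).card ≠ 0 := by
      intro h0
      apply h
      refine Finset.eq_of_subset_of_card_le
        (Finset.sdiff_eq_empty_iff_subset.1 (Finset.card_eq_zero.1 h0)) ?_
      rw [LabeledCycle.card_edges, LabeledCycle.card_edges]
    simp [condSecond, signal_zero, h1]

/-- The mean of the weighted count under the null law. -/
theorem integral_cycleSum_null (hp : IsCorrelatedPrior p rho C) (lam' mu' rho' : ℝ)
    (R : Finset (LabeledCycle k (Fin n))) :
    ∫ M, cycleSum lam' mu' rho' R M ∂(spikedLaw 0 0 p n) = 0 := by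
  rw [integral_cycleSum_eq hp (by simp) (by simp)]
  refine Finset.sum_eq_zero fun q _ => ?_
  have h : labelWeight 0 0 rho q.2 = 0 :=
    Finset.prod_eq_zero (Finset.mem_univ 0) (by cases q.2 0 <;> simp [coef])
  rw [integral_cycleProd hp (by simp) (by simp), h, mul_zero, mul_zero]

/-- The second moment of the weighted count under the null law. -/
theorem integral_cycleSum_sq_null (hp : IsCorrelatedPrior p rho C) (lam' mu' rho' : ℝ)
    {R : Finset (LabeledCycle k (Fin n))}
    (hR : ∀ q ∈ R, ∀ q' ∈ R, q.edges = q'.edges → q = q') :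
    ∫ M, cycleSum lam' mu' rho' R M ^ 2 ∂(spikedLaw 0 0 p n) =
      ∑ q ∈ R, labelWeight lam' mu' rho' q.2 ^ 2 := by
  rw [integral_cycleSum_sq_eq hp (by simp) (by simp)]
  refine Finset.sum_congr rfl fun q hq => ?_
  rw [Finset.sum_eq_single q]
  · rw [integral_cycleProd_mul_null hp, if_pos rfl]
    ring
  · intro q' hq' hne
    rw [integral_cycleProd_mul_null hp, if_neg fun h => hne (hR q hq q' hq' h).symm, mul_zero]
  · exact fun h => absurd hq h

theorem covariance_cycleProd_le (hp : IsCorrelatedPrior p rho C) (hlam : 0 ≤ lam ∧ lam ≤ 1)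
    (hmu : 0 ≤ mu ∧ mu ≤ 1) (hrho : 0 ≤ rho) (hn : 0 < n) {B : ℝ}
    (hB : ∫ z, envelope z ^ 4 ∂p ≤ B) {q q' : LabeledCycle k (Fin n)} (h : q.edges ≠ q'.edges) :
    (∫ M, cycleProd q M * cycleProd q' M ∂(spikedLaw lam mu p n)) -
      (∫ M, cycleProd q M ∂(spikedLaw lam mu p n)) *
        ∫ M, cycleProd q' M ∂(spikedLaw lam mu p n) ≤
      (1 / (n : ℝ)) ^ (k + 4) * B ^ (k + 3) * (n : ℝ) ^ LabeledCycle.overlap q q' := by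
  have hlam1 : |lam| ≤ 1 := by rw [abs_of_nonneg hlam.1]; exact hlam.2
  have hmu1 : |mu| ≤ 1 := by rw [abs_of_nonneg hmu.1]; exact hmu.2
  have hB0 : 0 ≤ ∫ z, envelope z ^ 4 ∂p := zero_le_one.trans hp.one_le_integral_envelope
  have hB1 : 0 ≤ B := hB0.trans hB
  have hn1 : (1 : ℝ) ≤ n := by exact_mod_cast hn
  rcases eq_or_ne (LabeledCycle.overlap q q') 0 with h0 | h0
  · rw [integral_cycleProd_mul_of_disjoint hp hlam1 hmu1 h0, sub_self]
    positivity
  · have h1 := integral_cycleProd_mul_le hp hlam1 hmu1 q q'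
    have h2 : 0 ≤ (∫ M, cycleProd q M ∂(spikedLaw lam mu p n)) *
        ∫ M, cycleProd q' M ∂(spikedLaw lam mu p n) := by
      rw [integral_cycleProd hp hlam1 hmu1, integral_cycleProd hp hlam1 hmu1]
      have h3 := labelWeight_nonneg hlam.1 hmu.1 hrho q.2
      have h4 := labelWeight_nonneg hlam.1 hmu.1 hrho q'.2
      positivity
    have h3 := LabeledCycle.card_inter_edges_lt_overlap h h0
    have h4 : (q.edges ∩ q'.edges).card ≤ k + 3 := by
      rw [← LabeledCycle.card_edges q]
      exact Finset.card_le_card Finset.inter_subset_left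
    set e := (q.edges ∩ q'.edges).card
    have h5 : (1 / (n : ℝ)) ^ (k + 3 - e) = (1 / (n : ℝ)) ^ (k + 4) * (n : ℝ) ^ (e + 1) := by
      have h6 : k + 4 = (k + 3 - e) + (e + 1) := by omega
      rw [h6, pow_add, mul_assoc, ← mul_pow, one_div_mul_cancel (by positivity), one_pow, mul_one]
    have h7 : (n : ℝ) ^ (e + 1) ≤ (n : ℝ) ^ LabeledCycle.overlap q q' :=
      pow_le_pow_right₀ hn1 h3
    calc _ ≤ (1 / (n : ℝ)) ^ (k + 3 - e) * (∫ z, envelope z ^ 4 ∂p) ^ (k + 3) := by linarith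
      _ ≤ (1 / (n : ℝ)) ^ (k + 4) * (n : ℝ) ^ LabeledCycle.overlap q q' * B ^ (k + 3) := by
          rw [h5]
          gcongr
      _ = _ := by ring

theorem card_labeledCycle_le : (Fintype.card (LabeledCycle k (Fin n)) : ℝ) ≤
    (2 * (n : ℝ)) ^ (k + 3) := by
  have h1 : Fintype.card (LabeledCycle k (Fin n)) ≤ (2 * n) ^ (k + 3) := by
    rw [Fintype.card_prod, Fintype.card_embedding_eq, Fintype.card_fun, Fintype.card_fin,
      Fintype.card_fin, Fintype.card_bool, mul_pow, mul_comm]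
    exact Nat.mul_le_mul_left _ (Nat.descFactorial_le_pow _ _)
  exact_mod_cast h1

/-- The variance of the weighted count under the spiked law. -/
theorem variance_cycleSum_le (hp : IsCorrelatedPrior p rho C) (hlam : 0 ≤ lam ∧ lam ≤ 1)
    (hmu : 0 ≤ mu ∧ mu ≤ 1) (hrho : 0 ≤ rho ∧ rho ≤ 1) (hn : 0 < n) {B : ℝ}
    (hB : ∫ z, envelope z ^ 4 ∂p ≤ B) {R : Finset (LabeledCycle k (Fin n))}
    (hR : ∀ q ∈ R, ∀ q' ∈ R, q.edges = q'.edges → q = q') :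
    variance (cycleSum lam mu rho R) (spikedLaw lam mu p n) ≤
      (∑ q ∈ R, labelWeight lam mu rho q.2 ^ 2) * (1 + 1 / (n : ℝ) * B ^ (k + 3)) +
        (n : ℝ) ^ (k + 3) * (1 / (n : ℝ) * (4 * B * (k + 4)) ^ (k + 3)) := by
  have := isProbabilityMeasure_spikedLaw lam mu hp n
  have hlam1 : |lam| ≤ 1 := by rw [abs_of_nonneg hlam.1]; exact hlam.2
  have hmu1 : |mu| ≤ 1 := by rw [abs_of_nonneg hmu.1]; exact hmu.2
  have hB0 : 0 ≤ ∫ z, envelope z ^ 4 ∂p := zero_le_one.trans hp.one_le_integral_envelope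
  have hB1 : 0 ≤ B := hB0.trans hB
  have hn1 : (1 : ℝ) ≤ n := by exact_mod_cast hn
  set D : ℝ := (1 / (n : ℝ)) ^ (k + 4) * B ^ (k + 3) with hD
  have hD0 : 0 ≤ D := by positivity
  have hterm : ∀ q ∈ R, ∀ q' ∈ R, labelWeight lam mu rho q.2 * labelWeight lam mu rho q'.2 *
      (∫ M, cycleProd q M * cycleProd q' M ∂(spikedLaw lam mu p n)) -
      (labelWeight lam mu rho q.2 * ∫ M, cycleProd q M ∂(spikedLaw lam mu p n)) *
        (labelWeight lam mu rho q'.2 * ∫ M, cycleProd q' M ∂(spikedLaw lam mu p n)) ≤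
      (if q = q' then labelWeight lam mu rho q.2 ^ 2 * (1 + 1 / (n : ℝ) * B ^ (k + 3)) else 0) +
        D * (n : ℝ) ^ LabeledCycle.overlap q q' := by
    intro q hq q' hq'
    have w0 := labelWeight_nonneg hlam.1 hmu.1 hrho.1 q.2
    have w0' := labelWeight_nonneg hlam.1 hmu.1 hrho.1 q'.2
    have w1 := labelWeight_le_one hlam hmu hrho q.2
    have w1' := labelWeight_le_one hlam hmu hrho q'.2
    have hpos : 0 ≤ D * (n : ℝ) ^ LabeledCycle.overlap q q' := by positivity
    split_ifs with h
    · subst h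
      have h1 := integral_cycleProd_mul_le_of_edges_eq hp hlam1 hmu1 hn (rfl : q.edges = q.edges)
      have h2 : (∫ z, envelope z ^ 4 ∂p) ^ (k + 3) ≤ B ^ (k + 3) := by gcongr
      have h3 : (∫ M, cycleProd q M * cycleProd q M ∂(spikedLaw lam mu p n)) ≤
          1 + 1 / (n : ℝ) * B ^ (k + 3) := h1.trans (by gcongr)
      have h4 := mul_le_mul_of_nonneg_left h3 (mul_nonneg w0 w0)
      nlinarith [mul_self_nonneg (labelWeight lam mu rho q.2 *
        ∫ M, cycleProd q M ∂(spikedLaw lam mu p n))]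
    · have h1 := covariance_cycleProd_le hp hlam hmu hrho.1 hn hB
        (fun he => h (hR q hq q' hq' he))
      have h2 : labelWeight lam mu rho q.2 * labelWeight lam mu rho q'.2 ≤ 1 :=
        mul_le_one₀ w1 w0' w1'
      have h3 := mul_le_mul_of_nonneg_left h1 (mul_nonneg w0 w0')
      have h4 := mul_le_of_le_one_left hpos h2
      rw [zero_add]
      refine le_trans (le_of_eq ?_) (h3.trans h4)
      ring
  rw [variance_eq_sub (memLp_cycleSum hp hlam1 hmu1 lam mu rho R)]
  have e1 : ∫ M, (cycleSum lam mu rho R ^ 2) M ∂(spikedLaw lam mu p n) =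
      ∫ M, cycleSum lam mu rho R M ^ 2 ∂(spikedLaw lam mu p n) := rfl
  rw [e1, integral_cycleSum_sq_eq hp hlam1 hmu1, integral_cycleSum_eq hp hlam1 hmu1, sq,
    Finset.sum_mul_sum, ← Finset.sum_sub_distrib]
  simp only [← Finset.sum_sub_distrib]
  refine (Finset.sum_le_sum fun q hq => Finset.sum_le_sum fun q' hq' => hterm q hq q' hq').trans ?_
  simp only [Finset.sum_add_distrib, Finset.sum_ite_eq, Finset.sum_ite_mem, Finset.inter_self]
  rw [Finset.sum_mul]
  have hov : ∑ q ∈ R, ∑ q' ∈ R, D * (n : ℝ) ^ LabeledCycle.overlap q q' ≤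
      (n : ℝ) ^ (k + 3) * (1 / (n : ℝ) * (4 * B * (k + 4)) ^ (k + 3)) := by
    calc ∑ q ∈ R, ∑ q' ∈ R, D * (n : ℝ) ^ LabeledCycle.overlap q q'
        ≤ ∑ q : LabeledCycle k (Fin n), ∑ q' : LabeledCycle k (Fin n),
            D * (n : ℝ) ^ LabeledCycle.overlap q q' := by
          refine (Finset.sum_le_sum fun q _ => Finset.sum_le_sum_of_subset_of_nonneg
            (Finset.subset_univ R) fun _ _ _ => by positivity).trans ?_
          exact Finset.sum_le_sum_of_subset_of_nonneg (Finset.subset_univ R) fun _ _ _ =>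
            Finset.sum_nonneg fun _ _ => by positivity
      _ ≤ ∑ q : LabeledCycle k (Fin n), D * (2 * (n * (k + 4))) ^ (k + 3) := by
          refine Finset.sum_le_sum fun q _ => ?_
          rw [← Finset.mul_sum]
          have := LabeledCycle.sum_pow_overlap_le q
          rw [Fintype.card_fin] at this
          gcongr
      _ ≤ (2 * (n : ℝ)) ^ (k + 3) * (D * (2 * (n * (k + 4))) ^ (k + 3)) := by
          rw [Finset.sum_const, Finset.card_univ, nsmul_eq_mul]
          have := card_labeledCycle_le (k := k) (n := n)
          gcongr
      _ = _ := by
          have h1 : (1 / (n : ℝ)) ^ (k + 3) * (n : ℝ) ^ (k + 3) = 1 := by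
            rw [← mul_pow, one_div_mul_cancel (by positivity), one_pow]
          have h4 : (4 : ℝ) ^ (k + 3) = 2 ^ (k + 3) * 2 ^ (k + 3) := by
            rw [← mul_pow]
            norm_num
          rw [hD]
          simp only [mul_pow, h4]
          rw [pow_succ (1 / (n : ℝ)) (k + 3)]
          linear_combination (2 ^ (k + 3) * 2 ^ (k + 3) * (n : ℝ) ^ (k + 3) * (1 / (n : ℝ)) *
            B ^ (k + 3) * ((k : ℝ) + 4) ^ (k + 3)) * h1
  gcongr

/-- A lower bound on the sum of the squared weights over all decorated cycles. -/
theorem pow_mul_sum_le_sum_representatives (hn : 2 * (k + 3) ^ 2 ≤ n)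
    {R : Finset (LabeledCycle k (Fin n))}
    (hR : ∀ q : LabeledCycle k (Fin n), ∃ q' ∈ R, q'.edges = q.edges) :
    (n : ℝ) ^ (k + 3) * ∑ s : Fin (k + 3) → Bool, labelWeight lam mu rho s ^ 2 ≤
      2 * (k + 3) ^ 2 * ∑ q ∈ R, labelWeight lam mu rho q.2 ^ 2 := by
  classical
  have h1 : ∑ q : LabeledCycle k (Fin n), labelWeight lam mu rho q.2 ^ 2 ≤
      (k + 3) ^ 2 * ∑ q ∈ R, labelWeight lam mu rho q.2 ^ 2 := by
    choose f hf hfe using hR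
    rw [← Finset.sum_fiberwise_of_maps_to (s := Finset.univ) (t := R) (g := f)
      fun q _ => hf q, Finset.mul_sum]
    refine Finset.sum_le_sum fun q _ => ?_
    have h2 : ∀ q' ∈ Finset.univ.filter fun q' => f q' = q,
        labelWeight lam mu rho q'.2 ^ 2 = labelWeight lam mu rho q.2 ^ 2 := by
      intro q' hq'
      have h3 := (Finset.mem_filter.1 hq').2
      rw [LabeledCycle.labelWeight_eq_of_edges_eq lam mu rho
        (show q'.edges = q.edges by rw [← h3, hfe])]
    rw [Finset.sum_congr rfl h2, Finset.sum_const, nsmul_eq_mul]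
    refine mul_le_mul_of_nonneg_right ?_ (sq_nonneg _)
    have h4 : (Finset.univ.filter fun q' => f q' = q).card ≤ (k + 3) ^ 2 := by
      refine le_trans (Finset.card_le_card ?_) (LabeledCycle.card_edges_eq_le q)
      intro q' hq'
      have h3 := (Finset.mem_filter.1 hq').2
      simp only [Finset.mem_filter, Finset.mem_univ, true_and]
      rw [← h3, hfe]
    exact_mod_cast h4
  have h2 : ∑ q : LabeledCycle k (Fin n), labelWeight lam mu rho q.2 ^ 2 =
      (n.descFactorial (k + 3) : ℝ) *
        ∑ s : Fin (k + 3) → Bool, labelWeight lam mu rho s ^ 2 := by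
    have h3 : ∑ q : LabeledCycle k (Fin n), labelWeight lam mu rho q.2 ^ 2 =
        ∑ _φ : Fin (k + 3) ↪ Fin n, ∑ s : Fin (k + 3) → Bool,
          labelWeight lam mu rho s ^ 2 := Fintype.sum_prod_type _
    rw [h3, Finset.sum_const, Finset.card_univ, Fintype.card_embedding_eq, Fintype.card_fin,
      Fintype.card_fin, nsmul_eq_mul]
  have h3 : (n : ℝ) ^ (k + 3) ≤ 2 * (n.descFactorial (k + 3) : ℝ) := by
    have h4 := Nat.pow_sub_le_descFactorial n (k + 3)
    have hkn : k + 3 ≤ n := by nlinarith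
    have hn0 : (0 : ℝ) < n := by
      have : 0 < n := by omega
      exact_mod_cast this
    have hn' : (2 * (k + 3) ^ 2 : ℝ) ≤ n := by exact_mod_cast hn
    have h5 : ((n : ℝ) - (k + 3)) ^ (k + 3) ≤ n.descFactorial (k + 3) := by
      have h6 : ((n : ℝ) - (k + 3)) ≤ ((n + 1 - (k + 3) : ℕ) : ℝ) := by
        rw [Nat.cast_sub (by omega)]
        push_cast
        linarith
      have h7 : 0 ≤ (n : ℝ) - (k + 3) := by
        have : ((k + 3 : ℕ) : ℝ) ≤ n := by exact_mod_cast hkn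
        push_cast at this
        linarith
      calc ((n : ℝ) - (k + 3)) ^ (k + 3) ≤ ((n + 1 - (k + 3) : ℕ) : ℝ) ^ (k + 3) := by gcongr
        _ ≤ _ := by exact_mod_cast h4
    have h8 := one_add_mul_le_pow (a := -((k + 3 : ℝ) / n)) (by
      have : (k + 3 : ℝ) / n ≤ 1 := by
        rw [div_le_one hn0]
        exact_mod_cast hkn
      linarith) (k + 3)
    have h9 : (1 / 2 : ℝ) ≤ 1 + ((k + 3 : ℕ) : ℝ) * -((k + 3 : ℝ) / n) := by
      have : (k + 3 : ℝ) ^ 2 / n ≤ 1 / 2 := by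
        rw [div_le_div_iff₀ hn0 (by norm_num)]
        linarith
      push_cast
      have e : (k + 3 : ℝ) * -((k + 3 : ℝ) / n) = - ((k + 3 : ℝ) ^ 2 / n) := by ring
      rw [e]
      linarith
    have h10 : ((n : ℝ) - (k + 3)) ^ (k + 3) =
        (n : ℝ) ^ (k + 3) * (1 + -((k + 3 : ℝ) / n)) ^ (k + 3) := by
      rw [← mul_pow]
      congr 1
      field_simp
      ring
    have h11 : (n : ℝ) ^ (k + 3) * (1 / 2) ≤ (n : ℝ) ^ (k + 3) * (1 + -((k + 3 : ℝ) / n)) ^ (k + 3) :=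
      mul_le_mul_of_nonneg_left (h9.trans h8) (by positivity)
    linarith
  have h4 : 0 ≤ ∑ s : Fin (k + 3) → Bool, labelWeight lam mu rho s ^ 2 :=
    Finset.sum_nonneg fun _ _ => sq_nonneg _
  have h5 := mul_le_mul_of_nonneg_right h3 h4
  rw [h2] at h1
  linarith

end

/-! ### Detection -/

theorem measure_le_mul_integral_le {Ω : Type*} [MeasurableSpace Ω] {P : Measure Ω}
    [IsProbabilityMeasure P] {g : Ω → ℝ} (hg : MemLp g 2 P) (hm : 0 < ∫ ω, g ω ∂P) {c : ℝ}
    (hc : c < 1) : P {ω | g ω ≤ c * ∫ ω, g ω ∂P} ≤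
      ENNReal.ofReal (variance g P / ((1 - c) * ∫ ω, g ω ∂P) ^ 2) := by
  refine (measure_mono fun ω hω => ?_).trans
    (meas_ge_le_variance_div_sq hg (mul_pos (sub_pos.2 hc) hm))
  have h : g ω ≤ c * ∫ ω, g ω ∂P := hω
  change (1 - c) * ∫ ω, g ω ∂P ≤ |g ω - ∫ ω, g ω ∂P|
  rw [abs_sub_comm]
  exact le_trans (by linarith) (le_abs_self _)

theorem measure_ge_le_of_integral_eq_zero {Ω : Type*} [MeasurableSpace Ω] {Q : Measure Ω}
    [IsProbabilityMeasure Q] {g : Ω → ℝ} (hg : MemLp g 2 Q) (h0 : ∫ ω, g ω ∂Q = 0) {t : ℝ}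
    (ht : 0 < t) : Q {ω | t ≤ g ω} ≤ ENNReal.ofReal ((∫ ω, g ω ^ 2 ∂Q) / t ^ 2) := by
  have h1 := meas_ge_le_variance_div_sq hg ht
  have h2 : variance g Q = ∫ ω, g ω ^ 2 ∂Q := by
    rw [variance_eq_sub hg, h0]
    simp
  rw [h2] at h1
  refine (measure_mono fun ω hω => ?_).trans h1
  have h : t ≤ g ω := hω
  change t ≤ |g ω - ∫ ω, g ω ∂Q|
  rw [h0, sub_zero]
  exact h.trans (le_abs_self _)

/-- A bound on the sum of the two error probabilities of the cycle test. -/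
theorem error_le {p : Measure (ℝ × ℝ)} {lam mu rho C B δ r c : ℝ} {k n : ℕ}
    (hp : IsCorrelatedPrior p rho C) (hlam : 0 < lam ∧ lam ≤ 1) (hmu : 0 < mu ∧ mu ≤ 1)
    (hrho : 0 < rho ∧ rho ≤ 1) (hB : ∫ z, envelope z ^ 4 ∂p ≤ B) (hδ : 0 < δ) (hr : 1 < r)
    (hgrowth : δ * r ^ k ≤ ∑ s : Fin (k + 3) → Bool, labelWeight lam mu rho s ^ 2)
    (hn : 2 * (k + 3) ^ 2 ≤ n) (hc : 0 < c ∧ c < 1) {u v : ℝ}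
    (hu : u = 2 * (k + 3) ^ 2 / (δ * r ^ k))
    (hv : v = 1 / (n : ℝ) * (4 * B * (k + 4)) ^ (k + 3)) :
    spikedLaw lam mu p n {M | cycleStat lam mu rho (k + 3) n M ≤
        c * ∫ M, cycleStat lam mu rho (k + 3) n M ∂(spikedLaw lam mu p n)} +
      nullLaw n {M | c * ∫ M, cycleStat lam mu rho (k + 3) n M ∂(spikedLaw lam mu p n) ≤
        cycleStat lam mu rho (k + 3) n M} ≤
      ENNReal.ofReal ((u * (1 + v) + u ^ 2 * v) / (1 - c) ^ 2 + u / c ^ 2) := by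
  have hpr := hp.prob
  have hP := isProbabilityMeasure_spikedLaw lam mu hp n
  have hQ := isProbabilityMeasure_spikedLaw 0 0 hp n
  have hlam1 : |lam| ≤ 1 := by rw [abs_of_nonneg hlam.1.le]; exact hlam.2
  have hmu1 : |mu| ≤ 1 := by rw [abs_of_nonneg hmu.1.le]; exact hmu.2
  have hn0 : 0 < n := lt_of_lt_of_le (by positivity) hn
  have hnr : (0 : ℝ) < n := by exact_mod_cast hn0
  have hB1 : 1 ≤ B := hp.one_le_integral_envelope.trans hB
  obtain ⟨R, hR1, hR2, hR3⟩ := exists_representatives k n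
  set κ : ℝ := 1 / √((n : ℝ) ^ (k + 3) * cycleBeta lam mu rho (k + 3)) with hκ
  have hκ0 : 0 < κ := by
    have := cycleBeta_pos hlam.1 hmu.1 hrho.1 k
    positivity
  set g : MatrixPair n → ℝ := cycleSum lam mu rho R with hg
  have hf : ∀ M, cycleStat lam mu rho (k + 3) n M = κ * g M := fun M => hR3 lam mu rho M
  set T : ℝ := ∑ q ∈ R, labelWeight lam mu rho q.2 ^ 2 with hT
  set m : ℝ := ∫ M, g M ∂(spikedLaw lam mu p n) with hm
  have hNT : (n : ℝ) ^ (k + 3) ≤ u * T := by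
    have h1 := pow_mul_sum_le_sum_representatives (lam := lam) (mu := mu) (rho := rho) hn hR2
    have h2 : (n : ℝ) ^ (k + 3) * (δ * r ^ k) ≤ 2 * (k + 3) ^ 2 * T :=
      (mul_le_mul_of_nonneg_left hgrowth (by positivity)).trans h1
    have h3 : 0 < δ * r ^ k := by positivity
    rw [hu, div_mul_eq_mul_div, le_div_iff₀ h3]
    exact h2
  have hN : 0 < (n : ℝ) ^ (k + 3) := by positivity
  have hu0 : 0 ≤ u := by rw [hu]; positivity
  have hT0 : 0 < T := by
    by_contra h
    have := mul_nonpos_of_nonneg_of_nonpos hu0 (not_lt.1 h)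
    linarith
  have hmT : m = (1 / √(n : ℝ)) ^ (k + 3) * T := integral_cycleSum hp hlam1 hmu1 R
  have hm0 : 0 < m := by rw [hmT]; positivity
  have hm2 : m ^ 2 = T ^ 2 / (n : ℝ) ^ (k + 3) := by
    rw [hmT, mul_pow, ← pow_mul, mul_comm (k + 3) 2, pow_mul, div_pow,
      Real.sq_sqrt hnr.le, one_pow, div_pow, one_pow]
    ring
  have hv0 : 0 ≤ v := by rw [hv]; positivity
  have hBv : 1 / (n : ℝ) * B ^ (k + 3) ≤ v := by
    rw [hv]
    have : B ≤ 4 * B * (k + 4) := by nlinarith [Nat.cast_nonneg (α := ℝ) k]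
    gcongr
  have hNTd : (n : ℝ) ^ (k + 3) / T ≤ u := (div_le_iff₀ hT0).2 hNT
  have hNTd0 : 0 ≤ (n : ℝ) ^ (k + 3) / T := by positivity
  have hint : ∫ M, cycleStat lam mu rho (k + 3) n M ∂(spikedLaw lam mu p n) = κ * m := by
    simp only [hf, integral_const_mul, hm]
  have hset1 : {M | cycleStat lam mu rho (k + 3) n M ≤ c * (κ * m)} = {M | g M ≤ c * m} := by
    ext M
    simp only [Set.mem_ofPred_eq, hf]
    rw [mul_left_comm, mul_le_mul_iff_right₀ hκ0]
  have hset2 : {M | c * (κ * m) ≤ cycleStat lam mu rho (k + 3) n M} = {M | c * m ≤ g M} := by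
    ext M
    simp only [Set.mem_ofPred_eq, hf]
    rw [mul_left_comm, mul_le_mul_iff_right₀ hκ0]
  have h1c : 0 < 1 - c := sub_pos.2 hc.2
  have hfirst := measure_le_mul_integral_le (memLp_cycleSum hp hlam1 hmu1 lam mu rho R) hm0 hc.2
  have hsecond := measure_ge_le_of_integral_eq_zero
    (memLp_cycleSum hp (by simp) (by simp) lam mu rho R)
    (integral_cycleSum_null hp lam mu rho R) (mul_pos hc.1 hm0)
  rw [integral_cycleSum_sq_null hp lam mu rho hR1, spikedLaw_zero] at hsecond
  rw [hint, hset1, hset2, ENNReal.ofReal_add (by positivity) (by positivity)]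
  refine add_le_add (hfirst.trans (ENNReal.ofReal_le_ofReal ?_))
    (hsecond.trans (ENNReal.ofReal_le_ofReal ?_))
  · have h1 := variance_cycleSum_le hp ⟨hlam.1.le, hlam.2⟩ ⟨hmu.1.le, hmu.2⟩
      ⟨hrho.1.le, hrho.2⟩ hn0 hB hR1
    rw [← hv] at h1
    have h2 : variance g (spikedLaw lam mu p n) ≤ T * (1 + v) + (n : ℝ) ^ (k + 3) * v := by
      refine h1.trans ?_
      gcongr
    change variance g (spikedLaw lam mu p n) / ((1 - c) * m) ^ 2 ≤ _
    calc variance g (spikedLaw lam mu p n) / ((1 - c) * m) ^ 2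
        ≤ (T * (1 + v) + (n : ℝ) ^ (k + 3) * v) / ((1 - c) * m) ^ 2 := by gcongr
      _ = ((n : ℝ) ^ (k + 3) / T * (1 + v) + ((n : ℝ) ^ (k + 3) / T) ^ 2 * v) / (1 - c) ^ 2 := by
          rw [mul_pow, hm2]
          field_simp
      _ ≤ _ := by gcongr
  · calc T / (c * m) ^ 2 = (n : ℝ) ^ (k + 3) / T / c ^ 2 := by
          rw [mul_pow, hm2]
          field_simp
      _ ≤ _ := by gcongr

theorem integrable_cycleStat {p : Measure (ℝ × ℝ)} {lam mu rho C : ℝ}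
    (hp : IsCorrelatedPrior p rho C) (hlam : |lam| ≤ 1) (hmu : |mu| ≤ 1) (l n : ℕ) :
    Integrable (cycleStat lam mu rho l n) (spikedLaw lam mu p n) := by
  have hP := isProbabilityMeasure_spikedLaw lam mu hp n
  rcases lt_or_ge l 3 with h | h
  · have h0 : cycleStat lam mu rho l n = fun _ => 0 := by
      funext M
      simp [cycleStat, cycleClasses_eq_empty h]
    rw [h0]
    exact integrable_const 0
  · obtain ⟨k, rfl⟩ := Nat.exists_eq_add_of_le' h
    obtain ⟨R, -, -, hR⟩ := exists_representatives k n
    have h0 : cycleStat lam mu rho (k + 3) n = fun M =>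
        1 / √((n : ℝ) ^ (k + 3) * cycleBeta lam mu rho (k + 3)) * cycleSum lam mu rho R M := by
      funext M
      exact hR lam mu rho M
    rw [h0]
    exact ((memLp_cycleSum hp hlam hmu lam mu rho R).integrable (by norm_num)).const_mul _

theorem eventually_pow_le_sqrt {l : ℕ → ℕ}
    (hl : (fun n : ℕ => (l n : ℝ)) =o[atTop]
      fun n : ℕ => Real.log (n : ℝ) / Real.log (Real.log (n : ℝ))) {D : ℝ} (hD : 1 ≤ D) :
    ∀ᶠ n : ℕ in atTop, (D * (l n + 1)) ^ l n ≤ √(n : ℝ) := by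
  have hlog : Tendsto (fun n : ℕ => Real.log (n : ℝ)) atTop atTop :=
    Real.tendsto_log_atTop.comp tendsto_natCast_atTop_atTop
  have hloglog : Tendsto (fun n : ℕ => Real.log (Real.log (n : ℝ))) atTop atTop :=
    Real.tendsto_log_atTop.comp hlog
  filter_upwards [hl.bound (show (0 : ℝ) < 1 / 4 by norm_num), hlog.eventually_ge_atTop (2 * D),
    hloglog.eventually_ge_atTop 1, eventually_gt_atTop 0] with n h1 h2 h3 h4
  have hL0 : 0 < Real.log n := by linarith
  have hLL0 : 0 < Real.log (Real.log n) := by linarith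
  have hn : (0 : ℝ) < n := by exact_mod_cast h4
  rw [Real.norm_of_nonneg (Nat.cast_nonneg _), Real.norm_of_nonneg (by positivity)] at h1
  have h5 : (l n : ℝ) * Real.log (Real.log n) ≤ 1 / 4 * Real.log n := by
    rw [← mul_div_assoc] at h1
    exact (le_div_iff₀ hLL0).1 h1
  have h6 : (l n : ℝ) ≤ Real.log n := by nlinarith [Nat.cast_nonneg (α := ℝ) (l n)]
  have h7 : D * (l n + 1) ≤ Real.log n ^ 2 := by nlinarith
  have h8 : 0 < D * (l n + 1) := by positivity
  have h9 : Real.log (D * (l n + 1)) ≤ 2 * Real.log (Real.log n) := by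
    have := Real.log_le_log h8 h7
    rwa [Real.log_pow] at this
  rw [Real.le_sqrt (by positivity) hn.le, ← Real.log_le_log_iff (by positivity) hn, Real.log_pow,
    Real.log_pow]
  push_cast
  nlinarith [Nat.cast_nonneg (α := ℝ) (l n)]

theorem mainTheorem2 (lam mu rho ε C : ℝ)
    (hlam : 0 ≤ lam ∧ lam ≤ 1) (hmu : 0 ≤ mu ∧ mu ≤ 1) (hrho : 0 ≤ rho ∧ rho ≤ 1)
    (hε : 0 < ε) (hF : 1 + ε < thresholdF lam mu rho 1)
    (prior : ℕ → Measure (ℝ × ℝ)) (hprior : ∀ n, IsCorrelatedPrior (prior n) rho C)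
    (l : ℕ → ℕ) (hl : Tendsto l atTop atTop)
    (hl' : (fun n : ℕ => (l n : ℝ)) =o[atTop]
      fun n : ℕ => Real.log (n : ℝ) / Real.log (Real.log (n : ℝ)))
    (c : ℝ) (hc : 0 < c ∧ c < 1) :
    let P : ∀ n : ℕ, Measure (MatrixPair n) := fun n => spikedLaw lam mu (prior n) n
    let Q : ∀ n : ℕ, Measure (MatrixPair n) := fun n => nullLaw n
    let f : ∀ n : ℕ, MatrixPair n → ℝ := fun n => cycleStat lam mu rho (l n) n
    let τ : ℕ → ℝ := fun n => c * ∫ M, f n M ∂(P n)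
    (∀ n, Integrable (f n) (P n)) ∧
    Tendsto (fun n => P n {M | f n M ≤ τ n} + Q n {M | τ n ≤ f n M}) atTop (𝓝 0) ∧
    StrongDetection P Q (fun n => cycleTest lam mu rho (l n) n (τ n)) := by
  intro P Q f τ
  obtain ⟨hlam0, hmu0, hrho0, hdet⟩ := pos_of_one_lt_thresholdF hlam hmu hrho.1 (by linarith)
  obtain ⟨δ, r, hδ, hr, hgrowth⟩ := exists_growth hlam0 hmu0 hrho0 hmu.2 hdet
  have hlam1 : |lam| ≤ 1 := by rw [abs_of_nonneg hlam.1]; exact hlam.2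
  have hmu1 : |mu| ≤ 1 := by rw [abs_of_nonneg hmu.1]; exact hmu.2
  set B : ℝ := 27 * (1 + 2 * C) with hB
  have hB1 : 1 ≤ B := (hprior 0).one_le_integral_envelope.trans (hprior 0).integral_envelope_le
  set u : ℕ → ℝ := fun n => 2 * r ^ 3 / δ * ((l n : ℝ) ^ 2 / r ^ l n) with hu
  set v : ℕ → ℝ := fun n => 1 / (n : ℝ) * (4 * B * (l n + 1)) ^ l n with hv
  have hpow := eventually_pow_le_sqrt hl' (D := 4 * B) (by linarith)
  have hu0 : Tendsto u atTop (𝓝 0) := by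
    have h1 := ((tendsto_pow_const_div_const_pow_of_one_lt 2 hr).comp hl).const_mul (2 * r ^ 3 / δ)
    simpa [hu, Function.comp_def] using h1
  have hv0 : Tendsto v atTop (𝓝 0) := by
    have h1 : Tendsto (fun n : ℕ => (√(n : ℝ))⁻¹) atTop (𝓝 0) :=
      tendsto_inv_atTop_zero.comp (Real.tendsto_sqrt_atTop.comp tendsto_natCast_atTop_atTop)
    refine tendsto_of_tendsto_of_tendsto_of_le_of_le' tendsto_const_nhds h1 ?_ ?_
    · exact Eventually.of_forall fun n => by simp only [hv]; positivity
    · filter_upwards [hpow, eventually_gt_atTop 0] with n h2 h3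
      have hn : (0 : ℝ) < n := by exact_mod_cast h3
      calc v n ≤ 1 / (n : ℝ) * √(n : ℝ) := by simp only [hv]; gcongr
        _ = (√(n : ℝ))⁻¹ := by
          rw [one_div_mul_eq_div, Real.sqrt_div_self', one_div]
  have herr : Tendsto (fun n => ENNReal.ofReal
      ((u n * (1 + v n) + u n ^ 2 * v n) / (1 - c) ^ 2 + u n / c ^ 2)) atTop (𝓝 0) := by
    have h1 : Tendsto (fun n => (u n * (1 + v n) + u n ^ 2 * v n) / (1 - c) ^ 2 + u n / c ^ 2)
        atTop (𝓝 ((0 * (1 + 0) + 0 ^ 2 * 0) / (1 - c) ^ 2 + 0 / c ^ 2)) :=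
      (((hu0.mul (hv0.const_add 1)).add ((hu0.pow 2).mul hv0)).div_const _).add (hu0.div_const _)
    have h2 := ENNReal.tendsto_ofReal h1
    simpa using h2
  have hmain : Tendsto (fun n => P n {M | f n M ≤ τ n} + Q n {M | τ n ≤ f n M}) atTop (𝓝 0) := by
    refine tendsto_of_tendsto_of_tendsto_of_le_of_le' tendsto_const_nhds herr
      (Eventually.of_forall fun _ => zero_le) ?_
    filter_upwards [hpow, hl.eventually_ge_atTop 3, eventually_gt_atTop 0] with n h1 h2 h3
    obtain ⟨k, hk⟩ := Nat.exists_eq_add_of_le' h2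
    have hn : 2 * (k + 3) ^ 2 ≤ n := by
      have hn1 : (1 : ℝ) ≤ n := by exact_mod_cast h3
      have h4 : (4 * B * (l n + 1)) ^ 2 ≤ (4 * B * (l n + 1)) ^ l n :=
        pow_le_pow_right₀ (by nlinarith [Nat.cast_nonneg (α := ℝ) (l n)]) (by omega)
      have h5 : √(n : ℝ) ≤ n := by
        rw [Real.sqrt_le_left (by linarith)]
        nlinarith
      have h6 : (4 * ((l n : ℝ) + 1)) ^ 2 ≤ (4 * B * (l n + 1)) ^ 2 := by
        gcongr
        linarith
      have h7 : (2 * (k + 3 : ℕ) ^ 2 : ℝ) ≤ n := by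
        rw [← hk]
        nlinarith [Nat.cast_nonneg (α := ℝ) (l n)]
      exact_mod_cast h7
    have h4 := error_le (hprior n) ⟨hlam0, hlam.2⟩ ⟨hmu0, hmu.2⟩ ⟨hrho0, hrho.2⟩
      (hprior n).integral_envelope_le hδ hr (hgrowth k) hn hc (u := u n) (v := v n)
      (by
        simp only [hu, hk, pow_add]
        push_cast
        field_simp)
      (by
        simp only [hv, hk]
        push_cast
        rw [show (k : ℝ) + 3 + 1 = k + 4 by ring])
    rw [← hk] at h4
    exact h4
  refine ⟨fun n => integrable_cycleStat (hprior n) hlam1 hmu1 (l n) n, hmain, ?_⟩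
  refine tendsto_of_tendsto_of_tendsto_of_le_of_le tendsto_const_nhds hmain
    (fun _ => zero_le) fun n => add_le_add (measure_mono fun M hM => ?_)
      (measure_mono fun M hM => ?_)
  · have h1 : cycleTest lam mu rho (l n) n (τ n) M = 0 := hM
    change f n M ≤ τ n
    unfold cycleTest at h1
    split_ifs at h1 with h2
    · exact absurd h1 (by decide)
    · exact (not_le.1 h2).le
  · have h1 : cycleTest lam mu rho (l n) n (τ n) M = 1 := hM
    change τ n ≤ f n M
    unfold cycleTest at h1
    split_ifs at h1 with h2
    · exact h2
    · exact absurd h1 (by decide)
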